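/- Let $K$ be a field. For a finite simple graph $G$ with vertex set $V$, let $J_G$ be its binomial edge ideal: the ideal of $S=K[x_v,y_v : v\in V]$ generated by the binomials $x_vy_w-x_wy_v$ with $\{v,w\}\in E(G)$. For a homogeneous ideal $0\ne J\subsetneq S$ let $\mathrm{reg}(J)=\max\{j-i : \beta_{i,j}(J)\neq 0\}$ be its Castelnuovo--Mumford regularity, where $\beta_{i,j}(J)$ are the graded Betti numbers of $J$ as a graded $S$-module; for the zero ideal put $\mathrm{reg}(0)=1$ (so that $\mathrm{reg}(J)=\mathrm{reg}(S/J)+1$ in all cases). A vertex of a graph is free if it belongs to exactly one maximal clique. A free cut edge of $G$ is a cut edge $e$ of $G$ whose two endpoints are free vertices of $G\setminus e$ (the graph $G$ with the edge $e$ deleted and all vertices kept). The reduced graph $\mathcal{R}(G)$ is obtained from $G$ by deleting all free cut edges of $G$ and keeping all vertices. Let $G$ be a finite connected simple graph and let $R_1,\dots,R_q$ be the connected components of $\mathcal{R}(G)$. Then $$\mathrm{reg}(J_G)=\sum_{i=1}^q \mathrm{reg}(J_{R_i}),$$ where each $J_{R_i}$ is the binomial edge ideal of $R_i$ in the polynomial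 ring on the variables of its own vertices. -/

import Mathlib

/-! Graded Betti numbers and regularity over a polynomial ring, binomial edge ideals, and the
reduced graph of a graph. -/

/-- A minimal graded free resolution
`⋯ → F 2 → F 1 → F 0 → M → 0`
of an `ℕ`-graded module `M = ⨁ d, ℳ d` over the standard graded polynomial ring
`S = MvPolynomial σ K`, with all `F i` of finite rank. Here `F i` is the free module
`S ^ (rank i)` with standard basis `Pi.single a 1`, and `deg i a` is the degree of its `a`-th basis
element, so `F i = ⨁ a, S(-deg i a)`. -/
structure MinimalGradedFreeResolution {K : Type*} [Field K] (σ : Type*) {M : Type*}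
    [AddCommGroup M] [Module K M] [Module (MvPolynomial σ K) M] (ℳ : ℕ → Submodule K M) where
  /-- the rank of `F i` -/
  rank : ℕ → ℕ
  /-- the degrees of the basis elements of `F i` -/
  deg : (i : ℕ) → Fin (rank i) → ℕ
  /-- the augmentation `F 0 → M` -/
  aug : (Fin (rank 0) → MvPolynomial σ K) →ₗ[MvPolynomial σ K] M
  /-- the differential `F (i + 1) → F i` -/
  d : (i : ℕ) → (Fin (rank (i + 1)) → MvPolynomial σ K) →ₗ[MvPolynomial σ K]
    (Fin (rank i) → MvPolynomial σ K)
  /-- the augmentation preserves degrees -/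
  aug_mem : ∀ a, aug (Pi.single a 1) ∈ ℳ (deg 0 a)
  /-- the differentials preserve degrees: each matrix entry is zero or homogeneous of degree the
  difference of the degrees of the two basis elements -/
  d_homogeneous : ∀ i a b, d i (Pi.single a 1) b = 0 ∨
    ∃ k, deg i b + k = deg (i + 1) a ∧ (d i (Pi.single a 1) b).IsHomogeneous k
  /-- minimality: the matrix entries lie in the homogeneous maximal ideal -/
  minimal : ∀ i a b, MvPolynomial.constantCoeff (d i (Pi.single a 1) b) = 0
  aug_surjective : Function.Surjective aug
  exact_zero : Function.Exact (d 0) aug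
  exact_succ : ∀ i, Function.Exact (d (i + 1)) (d i)

open Classical in
/-- The graded Betti number `β_{i,j}(M)`: the number of basis elements of degree `j` in the `i`-th
free module of a minimal graded free resolution of `M`. Such a resolution exists for every finitely
generated graded `M` (in finitely many variables) and is unique up to isomorphism, so the choice
made here does not matter. -/
noncomputable def gradedBetti {K : Type*} [Field K] (σ : Type*) {M : Type*}
    [AddCommGroup M] [Module K M] [Module (MvPolynomial σ K) M] (ℳ : ℕ → Submodule K M)
    (i j : ℕ) : ℕ :=
  if h : Nonempty (MinimalGradedFreeResolution σ ℳ) then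
    Nat.card {a : Fin (h.some.rank i) // h.some.deg i a = j}
  else 0

/-- The Castelnuovo-Mumford regularity `max {j - i : β_{i,j}(M) ≠ 0}`. The maximum is taken as a
supremum in the extended reals; it is `⊥` (minus infinity) for `M = 0`. -/
noncomputable def moduleRegularity {K : Type*} [Field K] (σ : Type*) {M : Type*}
    [AddCommGroup M] [Module K M] [Module (MvPolynomial σ K) M] (ℳ : ℕ → Submodule K M) : EReal :=
  ⨆ (i : ℕ) (j : ℕ) (_ : gradedBetti σ ℳ i j ≠ 0), (((j : ℝ) - (i : ℝ) : ℝ) : EReal)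

/-- The degree `k` part of an ideal `J` of `S`, regarded as an `S`-module: the elements of `J` that
are homogeneous polynomials of degree `k`. -/
noncomputable def Ideal.degreePart {K : Type*} [Field K] {σ : Type*} (J : Ideal (MvPolynomial σ K)) (k : ℕ) :
    Submodule K J :=
  (MvPolynomial.homogeneousSubmodule σ K k).comap (J.subtype.restrictScalars K)

open Classical in
/-- The regularity of a homogeneous ideal `J ⊊ S`: that of the graded module `J` if `J ≠ 0`, and
`reg 0 = 1`, which is the usual convention that keeps `reg J = reg (S / J) + 1` true for `J = 0`. -/
noncomputable def Ideal.regularity {K : Type*} [Field K] {σ : Type*}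
    (J : Ideal (MvPolynomial σ K)) : EReal :=
  if J = ⊥ then 1 else moduleRegularity σ J.degreePart

namespace SimpleGraph

/-- The binomial edge ideal `J_G` of `G` in `K[x_v, y_v : v ∈ V]`, generated by the binomials
`x_v y_w - x_w y_v` for the edges `{v, w}`, where `x_v = X (inl v)` and `y_v = X (inr v)`. -/
noncomputable def binomialEdgeIdeal (K : Type*) [Field K] {V : Type*} (G : SimpleGraph V) :
    Ideal (MvPolynomial (V ⊕ V) K) :=
  Ideal.span {f | ∃ v w, G.Adj v w ∧
    f = MvPolynomial.X (Sum.inl v) * MvPolynomial.X (Sum.inr w)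
      - MvPolynomial.X (Sum.inl w) * MvPolynomial.X (Sum.inr v)}

/-- A free vertex: one that lies in exactly one facet of the clique complex, that is, in exactly one
maximal clique. -/
def IsFreeVertex {V : Type*} (G : SimpleGraph V) (v : V) : Prop :=
  ∃! s : Set V, Maximal G.IsClique s ∧ v ∈ s

/-- A free cut edge: a cut edge `e` of `G` whose endpoints are free vertices of `G \ e`. -/
def IsFreeCutEdge {V : Type*} (G : SimpleGraph V) (e : Sym2 V) : Prop :=
  e ∈ G.edgeSet ∧ G.IsBridge e ∧ ∀ v ∈ e, (G.deleteEdges {e}).IsFreeVertex v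

/-- The reduced graph `R(G)`: all free cut edges of `G` are deleted. -/
def reducedGraph {V : Type*} (G : SimpleGraph V) : SimpleGraph V :=
  G.deleteEdges {e | G.IsFreeCutEdge e}

end SimpleGraph

/-!
Write `J` for the binomial edge ideal of a graph and `reg (S / J)` for the regularity of the
quotient, so that `reg J = reg (S / J) + 1` (`HasRegularity.regularity_eq`). The theorem says that
deleting a free cut edge lowers `reg (S / J)` by one, and that `reg (S / J)` is additive over
connected components. Deleting the `c` free cut edges of a connected graph leaves `c + 1`
components, so both sides equal `∑ reg (S / J_{R_i}) + c + 1`. The edges are deleted one at a time;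
what is needed of the endpoints, that their neighbours form a clique, survives the deletion of other
bridges, as no bridge lies in a triangle (`isClique_neighborSet_deleteEdges`).

*Cut edges.* Let `e = vw` be a bridge of `G` such that in `H = G ∖ e` the neighbours of `v` form a
clique, and so do those of `w`. Then
`J_G = J_H + (f)` with `f = x_v y_w - x_w y_v`, and `f` is a nonzerodivisor modulo `J_H`
(`mem_of_binomial_mul_mem`). The mapping cone of multiplication by `f`, which has degree two, on a
minimal resolution of `S / J_H` is then a minimal resolution of `S / J_G`, and its regularity is
larger by one (`HasRegularity.sup_span_singleton`). The nonzerodivisor property is proved without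
any primary decomposition: `S / J_H` is the algebra of the monoid of monomials modulo the congruence
`x_a y_b ∼ x_b y_a` for edges `ab`, and two monomials are congruent if and only if they have the same
degree in each pair `x_a, y_a` and the same total `x`-degree on each connected component of the
subgraph induced on their support. Since the neighbours of `v` and of `w` form cliques, adding these
two vertices to the support merges no two components; hence multiplication by `x_v y_w` is injective
on classes of monomials. On the component of `v` in `H`, which does not contain `w`, the term
`x_v y_w` has `x`-degree one and `x_w y_v` has `x`-degree zero. So the terms of highest `x`-degree
there in `x_v y_w g` cannot be cancelled by terms of `x_w y_v g`.

*Disjoint unions.* The tensor product over `K` of minimal resolutions of `S₁ / J₁` and `S₂ / J₂`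
is a minimal resolution of the quotient by `J₁ + J₂` in the joint variables
(`HasRegularity.tensor`). Exactness is transported by `K`-linear contractions.

*Resolutions.* To avoid families of modules, a resolution of a cyclic module is kept as one free
module whose basis is graded twice, by homological and by internal degree (`CyclicResolution`), and
`HasRegularity J r` says that `S / J` has such a resolution with regularity `r`. Existence
(`exists_hasRegularity`) comes from choosing minimal sets of homogeneous generators of the syzygies
again and again. That the regularity does not depend on the resolution is `gradedBetti_eq`: two
minimal covers of isomorphic graded modules have bases of the same degrees, and the isomorphism lifts
to the covers and restricts to the kernels.
-/

/-! ### The binomial edge ideal as the kernel of a monoid algebra -/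

namespace BinomialEdge

open MvPolynomial

variable {K : Type*} [Field K] {V : Type*}

/-- The degree of a monomial in the pair of variables `x_a, y_a`. -/
def vertexDegree (m : V ⊕ V →₀ ℕ) (a : V) : ℕ := m (Sum.inl a) + m (Sum.inr a)

/-- The vertices of `P` which occur in the monomial `m` form a union of connected components of the
subgraph of `G` induced on all the vertices which occur in `m`. -/
def ClosedOn (G : SimpleGraph V) (m : V ⊕ V →₀ ℕ) (P : Finset V) : Prop :=
  ∀ a b, G.Adj a b → vertexDegree m a ≠ 0 → vertexDegree m b ≠ 0 → a ∈ P → b ∈ P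

lemma vertexDegree_add (m m' : V ⊕ V →₀ ℕ) (a : V) :
    vertexDegree (m + m') a = vertexDegree m a + vertexDegree m' a := by
  simp only [vertexDegree, Finsupp.add_apply]; ring

/-- The congruence on monomials which identifies two monomials when they have the same vertex
degrees and, on every connected component of the subgraph induced on their common support, the same
total `x`-degree. The binomial edge ideal is the ideal of differences of congruent monomials. -/
def swapCon (G : SimpleGraph V) : AddCon (V ⊕ V →₀ ℕ) where
  r m m' := (∀ a, vertexDegree m a = vertexDegree m' a) ∧
    ∀ P, ClosedOn G m P → ∑ a ∈ P, m (Sum.inl a) = ∑ a ∈ P, m' (Sum.inl a)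
  iseqv :=
    { refl := fun m => ⟨fun _ => rfl, fun _ _ => rfl⟩
      symm := fun {m m'} h => ⟨fun a => (h.1 a).symm, fun P hP => (h.2 P (by
        intro a b; rw [h.1, h.1]; exact hP a b)).symm⟩
      trans := fun {m m' m''} h h' => ⟨fun a => (h.1 a).trans (h'.1 a), fun P hP =>
        (h.2 P hP).trans (h'.2 P (by intro a b; rw [← h.1, ← h.1]; exact hP a b))⟩ }
  add' := by
    intro m m' n n' h h'
    refine ⟨fun a => by rw [vertexDegree_add, vertexDegree_add, h.1, h'.1], fun P hP => ?_⟩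
    simp only [Finsupp.add_apply, Finset.sum_add_distrib]
    rw [h.2 P, h'.2 P]
    · intro a b hab ha hb
      exact hP a b hab (by rw [vertexDegree_add]; omega) (by rw [vertexDegree_add]; omega)
    · intro a b hab ha hb
      exact hP a b hab (by rw [vertexDegree_add]; omega) (by rw [vertexDegree_add]; omega)

lemma swapCon_iff {G : SimpleGraph V} {m m' : V ⊕ V →₀ ℕ} :
    swapCon G m m' ↔ (∀ a, vertexDegree m a = vertexDegree m' a) ∧
      ∀ P, ClosedOn G m P → ∑ a ∈ P, m (Sum.inl a) = ∑ a ∈ P, m' (Sum.inl a) := Iff.rfl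

variable (K) in
/-- The monomial map onto the monoid algebra of the quotient by `swapCon G`; its kernel is the
binomial edge ideal of `G`. -/
noncomputable def toQuot (G : SimpleGraph V) :
    MvPolynomial (V ⊕ V) K →ₐ[K] AddMonoidAlgebra K (swapCon G).Quotient :=
  AddMonoidAlgebra.mapDomainAlgHom K K (swapCon G).mk'

lemma toQuot_monomial (G : SimpleGraph V) (m : V ⊕ V →₀ ℕ) (c : K) :
    toQuot K G (monomial m c) = AddMonoidAlgebra.single (m : (swapCon G).Quotient) c :=
  AddMonoidAlgebra.mapDomain_single ..

lemma edge_binomial_eq (a b : V) :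
    (X (Sum.inl a) * X (Sum.inr b) - X (Sum.inl b) * X (Sum.inr a) : MvPolynomial (V ⊕ V) K) =
      monomial (Finsupp.single (Sum.inl a) 1 + Finsupp.single (Sum.inr b) 1) 1 -
        monomial (Finsupp.single (Sum.inl b) 1 + Finsupp.single (Sum.inr a) 1) 1 := by
  simp only [X, monomial_mul, mul_one]

lemma vertexDegree_pair [DecidableEq V] (a b c : V) :
    vertexDegree (Finsupp.single (Sum.inl a) 1 + Finsupp.single (Sum.inr b) 1) c =
      (if a = c then 1 else 0) + (if b = c then 1 else 0) := by
  classical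
  simp [vertexDegree, Finsupp.single_apply]

lemma sum_inl_pair [DecidableEq V] (a b : V) (P : Finset V) :
    ∑ c ∈ P, (Finsupp.single (Sum.inl a) 1 + Finsupp.single (Sum.inr b) 1 : V ⊕ V →₀ ℕ)
      (Sum.inl c) = if a ∈ P then 1 else 0 := by
  classical
  simp [Finsupp.single_apply]

lemma swapCon_pair {G : SimpleGraph V} {a b : V} (h : G.Adj a b) :
    swapCon G (Finsupp.single (Sum.inl a) 1 + Finsupp.single (Sum.inr b) 1)
      (Finsupp.single (Sum.inl b) 1 + Finsupp.single (Sum.inr a) 1) := by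
  classical
  refine swapCon_iff.2 ⟨fun c => by rw [vertexDegree_pair, vertexDegree_pair, add_comm],
    fun P hP => ?_⟩
  rw [sum_inl_pair, sum_inl_pair]
  have h1 := hP a b h (by rw [vertexDegree_pair]; simp) (by rw [vertexDegree_pair]; simp)
  have h2 := hP b a h.symm (by rw [vertexDegree_pair]; simp) (by rw [vertexDegree_pair]; simp)
  simp only [show a ∈ P ↔ b ∈ P from ⟨h1, h2⟩]

lemma binomialEdgeIdeal_le_ker (G : SimpleGraph V) :
    G.binomialEdgeIdeal K ≤ RingHom.ker (toQuot K G) := by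
  refine Ideal.span_le.2 ?_
  rintro f ⟨v, w, h, rfl⟩
  rw [SetLike.mem_coe, RingHom.mem_ker, edge_binomial_eq, map_sub, toQuot_monomial,
    toQuot_monomial, (swapCon G).eq.2 (swapCon_pair h), sub_self]

lemma swapCon_of_sub_mem {G : SimpleGraph V} {m m' : V ⊕ V →₀ ℕ}
    (h : (monomial m 1 - monomial m' 1 : MvPolynomial (V ⊕ V) K) ∈ G.binomialEdgeIdeal K) :
    swapCon G m m' := by
  have h1 := binomialEdgeIdeal_le_ker G h
  rw [RingHom.mem_ker, map_sub, toQuot_monomial, toQuot_monomial, sub_eq_zero] at h1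
  exact (swapCon G).eq.1 (AddMonoidAlgebra.single_left_injective one_ne_zero h1)

lemma swap_mem_of_adj {G : SimpleGraph V} {a b : V} (h : G.Adj a b) (m : V ⊕ V →₀ ℕ) :
    (monomial (m + Finsupp.single (Sum.inl a) 1 + Finsupp.single (Sum.inr b) 1) 1 -
      monomial (m + Finsupp.single (Sum.inl b) 1 + Finsupp.single (Sum.inr a) 1) 1 :
        MvPolynomial (V ⊕ V) K) ∈ G.binomialEdgeIdeal K := by
  have : (X (Sum.inl a) * X (Sum.inr b) - X (Sum.inl b) * X (Sum.inr a) :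
      MvPolynomial (V ⊕ V) K) ∈ G.binomialEdgeIdeal K := Ideal.subset_span ⟨a, b, h, rfl⟩
  have h2 := Ideal.mul_mem_left _ (monomial m 1) this
  rwa [edge_binomial_eq, mul_sub, monomial_mul, monomial_mul, mul_one, ← add_assoc,
    ← add_assoc] at h2

/-- Exchanging `x_a y_b` for `x_b y_a` along a path all of whose vertices occur in the monomial. -/
lemma swap_mem_of_path {G : SimpleGraph V} (U : V → Prop) {a b : V}
    (h : Relation.ReflTransGen (fun c d => G.Adj c d ∧ U c ∧ U d) a b) (m : V ⊕ V →₀ ℕ)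
    (hU : ∀ c, U c → vertexDegree
      (m + Finsupp.single (Sum.inl a) 1 + Finsupp.single (Sum.inr b) 1) c ≠ 0) :
    (monomial (m + Finsupp.single (Sum.inl a) 1 + Finsupp.single (Sum.inr b) 1) 1 -
      monomial (m + Finsupp.single (Sum.inl b) 1 + Finsupp.single (Sum.inr a) 1) 1 :
        MvPolynomial (V ⊕ V) K) ∈ G.binomialEdgeIdeal K := by
  classical
  induction h generalizing m with
  | refl => simp
  | @tail c b hac hcb ih =>
    by_cases hca : c = a
    · subst hca; exact swap_mem_of_adj hcb.1 m
    have hbc : b ≠ c := hcb.1.ne'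
    have hc := hU c hcb.2.1
    rw [add_assoc, vertexDegree_add, vertexDegree_pair, if_neg (Ne.symm hca), if_neg hbc,
      add_zero, add_zero, vertexDegree] at hc
    rcases (by omega : m (Sum.inl c) ≠ 0 ∨ m (Sum.inr c) ≠ 0) with hx | hy
    · obtain ⟨n, rfl⟩ : ∃ n, m = n + Finsupp.single (Sum.inl c) 1 :=
        ⟨m - Finsupp.single (Sum.inl c) 1, by
          rw [tsub_add_cancel_of_le]; simpa using Nat.one_le_iff_ne_zero.2 hx⟩
      have h1 : (_ : MvPolynomial (V ⊕ V) K) ∈ G.binomialEdgeIdeal K :=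
        swap_mem_of_adj hcb.1 (n + Finsupp.single (Sum.inl a) 1)
      have h2 := ih (n + Finsupp.single (Sum.inl b) 1) (by
        intro d hd
        have := hU d hd
        simp only [vertexDegree, Finsupp.add_apply, Finsupp.single_apply, Sum.inl.injEq,
          Sum.inr.injEq, reduceCtorEq, if_false] at this ⊢
        omega)
      convert Ideal.add_mem _ h1 h2 using 1
      rw [show n + Finsupp.single (Sum.inl a) 1 + Finsupp.single (Sum.inl b) 1 +
        Finsupp.single (Sum.inr c) 1 = n + Finsupp.single (Sum.inl b) 1 +
        Finsupp.single (Sum.inl a) 1 + Finsupp.single (Sum.inr c) 1 by abel, sub_add_sub_cancel]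
      congr 3 <;> abel
    · obtain ⟨n, rfl⟩ : ∃ n, m = n + Finsupp.single (Sum.inr c) 1 :=
        ⟨m - Finsupp.single (Sum.inr c) 1, by
          rw [tsub_add_cancel_of_le]; simpa using Nat.one_le_iff_ne_zero.2 hy⟩
      have h1 : (_ : MvPolynomial (V ⊕ V) K) ∈ G.binomialEdgeIdeal K :=
        swap_mem_of_adj hcb.1 (n + Finsupp.single (Sum.inr a) 1)
      have h2 := ih (n + Finsupp.single (Sum.inr b) 1) (by
        intro d hd
        have := hU d hd
        simp only [vertexDegree, Finsupp.add_apply, Finsupp.single_apply, Sum.inl.injEq,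
          Sum.inr.injEq, reduceCtorEq, if_false] at this ⊢
        omega)
      convert Ideal.add_mem _ h2 h1 using 1
      rw [show n + Finsupp.single (Sum.inr a) 1 + Finsupp.single (Sum.inl c) 1 +
        Finsupp.single (Sum.inr b) 1 = n + Finsupp.single (Sum.inr b) 1 +
        Finsupp.single (Sum.inl c) 1 + Finsupp.single (Sum.inr a) 1 by abel, sub_add_sub_cancel]
      congr 3 <;> abel

/-- Congruent monomials agree modulo the binomial edge ideal. If `m` has a larger exponent of `x_a`
than `m'`, then by equality of the `x`-degrees on the component of `a` it has a smaller exponent of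
some `x_b` on this component, and exchanging `x_a y_b` for `x_b y_a` brings `m` closer to `m'`. -/
lemma sub_mem_of_swapCon [Fintype V] {G : SimpleGraph V} {m m' : V ⊕ V →₀ ℕ}
    (h : swapCon G m m') :
    (monomial m 1 - monomial m' 1 : MvPolynomial (V ⊕ V) K) ∈ G.binomialEdgeIdeal K := by
  classical
  induction hn : ∑ a, (m (Sum.inl a) - m' (Sum.inl a)) using Nat.strong_induction_on
    generalizing m with
  | _ n ih =>
  obtain ⟨hd, hP⟩ := swapCon_iff.1 h
  by_cases hle : ∀ a, m (Sum.inl a) ≤ m' (Sum.inl a)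
  · have heq := (Finset.sum_eq_sum_iff_of_le (fun a _ => hle a)).1
      (hP Finset.univ fun _ _ _ _ _ _ => Finset.mem_univ _)
    have : m = m' := by
      ext i
      rcases i with a | a
      · exact heq a (Finset.mem_univ a)
      · have h1 := hd a
        have h2 := heq a (Finset.mem_univ a)
        simp only [vertexDegree] at h1
        omega
    simp [this]
  push Not at hle
  obtain ⟨a, ha⟩ := hle
  set U : V → Prop := fun c => vertexDegree m c ≠ 0 with hUdef
  set P : Finset V := Finset.univ.filter
    (Relation.ReflTransGen (fun c d => G.Adj c d ∧ U c ∧ U d) a) with hPdef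
  have hPc : ClosedOn G m P := by
    intro c d hcd hc hd' hcP
    simp only [hPdef, Finset.mem_filter, Finset.mem_univ, true_and] at hcP ⊢
    exact hcP.tail ⟨hcd, hc, hd'⟩
  obtain ⟨b, hbP, hb⟩ : ∃ b ∈ P, m (Sum.inl b) < m' (Sum.inl b) := by
    by_contra! hcon
    have := Finset.sum_lt_sum hcon ⟨a, by simp [hPdef, Relation.ReflTransGen.refl], ha⟩
    exact absurd (hP P hPc) this.ne'
  have hab : a ≠ b := by rintro rfl; omega
  have hbr : 0 < m (Sum.inr b) := by
    have := hd b
    simp only [vertexDegree] at this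
    omega
  obtain ⟨n0, rfl⟩ : ∃ n0, m = n0 + Finsupp.single (Sum.inl a) 1 + Finsupp.single (Sum.inr b) 1 := by
    refine ⟨m - (Finsupp.single (Sum.inl a) 1 + Finsupp.single (Sum.inr b) 1), ?_⟩
    rw [add_assoc, tsub_add_cancel_of_le]
    intro i
    rcases i with i | i
    · by_cases hi : a = i
      · subst hi; simp; omega
      · simp [hi]
    · by_cases hi : b = i
      · subst hi; simp; omega
      · simp [hi]
  have h1 : (_ : MvPolynomial (V ⊕ V) K) ∈ G.binomialEdgeIdeal K :=
    swap_mem_of_path U (Finset.mem_filter.1 hbP).2 n0 (fun c hc => hc)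
  have h2 := (swapCon G).trans ((swapCon G).symm (swapCon_of_sub_mem h1)) h
  have h3 := ih _ (by
    rw [← hn]
    refine Finset.sum_lt_sum (fun c _ => ?_) ⟨a, Finset.mem_univ a, ?_⟩
    · by_cases hcb : b = c
      · subst hcb
        simp [hab] at hb ⊢
        omega
      · simp only [Finsupp.add_apply, Finsupp.single_apply, Sum.inl.injEq, hcb, if_false,
          reduceCtorEq]
        omega
    · simp [hab.symm] at ha ⊢
      omega) h2 rfl
  have h4 := Ideal.add_mem _ h1 h3
  rwa [sub_add_sub_cancel] at h4

lemma ker_toQuot [Fintype V] (G : SimpleGraph V) :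
    RingHom.ker (toQuot K G) = G.binomialEdgeIdeal K := by
  refine le_antisymm (fun f hf => ?_) (binomialEdgeIdeal_le_ker G)
  -- A `K`-linear map sending a class of monomials to one of its representatives.
  let L : AddMonoidAlgebra K (swapCon G).Quotient →ₗ[K] MvPolynomial (V ⊕ V) K :=
    (Finsupp.linearCombination K fun q : (swapCon G).Quotient =>
      monomial (Quotient.out q : V ⊕ V →₀ ℕ) (1 : K)) ∘ₗ
      (AddMonoidAlgebra.coeffLinearEquiv K).toLinearMap
  have key : ∀ g : MvPolynomial (V ⊕ V) K, g - L (toQuot K G g) ∈ G.binomialEdgeIdeal K := by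
    intro g
    induction g using MvPolynomial.induction_on' with
    | monomial m c =>
      have h1 : L (toQuot K G (monomial m c)) =
          C c * monomial (Quotient.out (m : (swapCon G).Quotient)) 1 := by
        rw [toQuot_monomial, C_mul_monomial, mul_one]
        change Finsupp.linearCombination K _ (Finsupp.single _ c) = _
        refine (Finsupp.linearCombination_single K c _).trans ?_
        rw [smul_monomial, smul_eq_mul, mul_one]
      rw [h1, show monomial m c = C c * monomial m (1 : K) by rw [C_mul_monomial, mul_one],
        ← mul_sub]
      exact Ideal.mul_mem_left _ _ (sub_mem_of_swapCon
        ((swapCon G).symm (Quotient.exact (Quotient.out_eq (m : (swapCon G).Quotient)))))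
    | add p q hp hq =>
      rw [map_add, map_add, add_sub_add_comm]
      exact Ideal.add_mem _ hp hq
  have := key f
  rwa [RingHom.mem_ker.1 hf, map_zero, sub_zero] at this

/-- If `v` and `w` are non-adjacent and have cliques as neighbourhoods, then adjoining them to an
induced subgraph does not merge any of its components; hence multiplication by `z`, a monomial with
support `{v, w}`, is injective on classes of monomials. -/
lemma swapCon_of_add {G : SimpleGraph V} {v w : V}
    (hv : G.IsClique (G.neighborSet v)) (hw : G.IsClique (G.neighborSet w)) (hvw : ¬ G.Adj v w)
    {m m' z : V ⊕ V →₀ ℕ} (hz : ∀ c, vertexDegree z c ≠ 0 → c = v ∨ c = w)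
    (h : swapCon G (m + z) (m' + z)) : swapCon G m m' := by
  classical
  obtain ⟨h1, h2⟩ := swapCon_iff.1 h
  have hd : ∀ a, vertexDegree m a = vertexDegree m' a := fun a => by
    have := h1 a
    rwa [vertexDegree_add, vertexDegree_add, add_left_inj] at this
  refine swapCon_iff.2 ⟨hd, fun P hP => ?_⟩
  -- `P` is enlarged by those of the new vertices that are adjacent to it.
  set Q : Finset V := P.filter (fun a => vertexDegree m a ≠ 0) ∪
    (({v, w} : Finset V).filter fun a => vertexDegree m a = 0 ∧
      ∃ b ∈ P, vertexDegree m b ≠ 0 ∧ G.Adj a b) with hQ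
  have memQ : ∀ a, a ∈ Q ↔ (a ∈ P ∧ vertexDegree m a ≠ 0) ∨ ((a = v ∨ a = w) ∧
      vertexDegree m a = 0 ∧ ∃ b ∈ P, vertexDegree m b ≠ 0 ∧ G.Adj a b) := by
    intro a; simp [hQ]
  have hnb : ∀ a, (a = v ∨ a = w) → G.IsClique (G.neighborSet a) := by
    rintro a (rfl | rfl) <;> assumption
  have hnadj : ∀ a b, (a = v ∨ a = w) → (b = v ∨ b = w) → ¬ G.Adj a b := by
    rintro a b (rfl | rfl) (rfl | rfl) hab
    · exact hab.ne rfl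
    · exact hvw hab
    · exact hvw hab.symm
    · exact hab.ne rfl
  have hzz : ∀ a, vertexDegree (m + z) a ≠ 0 → vertexDegree m a = 0 → a = v ∨ a = w := by
    intro a ha h0
    rw [vertexDegree_add, h0, zero_add] at ha
    exact hz a ha
  have hQc : ClosedOn G (m + z) Q := by
    intro a b hab ha hb haQ
    rw [memQ] at haQ ⊢
    by_cases hb0 : vertexDegree m b = 0
    · rcases haQ with ⟨haP, ha0⟩ | ⟨ha', ha0, -⟩
      · exact Or.inr ⟨hzz b hb hb0, hb0, a, haP, ha0, hab.symm⟩
      · exact absurd hab (hnadj a b ha' (hzz b hb hb0))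
    · left
      refine ⟨?_, hb0⟩
      rcases haQ with ⟨haP, ha0⟩ | ⟨ha', ha0, c, hcP, hc0, hac⟩
      · exact hP a b hab ha0 hb0 haP
      · by_cases hcb : c = b
        · exact hcb ▸ hcP
        · exact hP c b (hnb a ha' hac hab hcb) hc0 hb0 hcP
  -- `P` and `Q` agree on the vertices which occur in `m`.
  have hsum : ∀ n : V ⊕ V →₀ ℕ, (∀ a, vertexDegree m a = vertexDegree n a) →
      ∑ a ∈ P, n (Sum.inl a) = ∑ a ∈ Q, n (Sum.inl a) := by
    intro n hn
    have e : ∀ R : Finset V, ∑ a ∈ R, n (Sum.inl a) =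
        ∑ a ∈ R.filter (fun a => vertexDegree m a ≠ 0), n (Sum.inl a) := by
      intro R
      refine (Finset.sum_filter_of_ne fun a _ ha => ?_).symm
      rw [hn, vertexDegree]; omega
    rw [e P, e Q]
    congr 1
    ext a
    simp only [Finset.mem_filter, memQ]
    tauto
  rw [hsum m fun _ => rfl, hsum m' hd]
  have := h2 Q hQc
  simpa only [Finsupp.add_apply, Finset.sum_add_distrib, add_left_inj] using this

/-- The binomial of a pair `v, w` of vertices in different components, both with cliques as
neighbourhoods, is a nonzerodivisor modulo the binomial edge ideal. -/
theorem mem_of_binomial_mul_mem [Fintype V] {G : SimpleGraph V} {v w : V}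
    (hv : G.IsClique (G.neighborSet v)) (hw : G.IsClique (G.neighborSet w))
    (hvw : ¬ G.Reachable v w) (g : MvPolynomial (V ⊕ V) K)
    (hg : (X (Sum.inl v) * X (Sum.inr w) - X (Sum.inl w) * X (Sum.inr v)) * g ∈
      G.binomialEdgeIdeal K) :
    g ∈ G.binomialEdgeIdeal K := by
  classical
  have hadj : ¬ G.Adj v w := fun h => hvw h.reachable
  set α : V ⊕ V →₀ ℕ := Finsupp.single (Sum.inl v) 1 + Finsupp.single (Sum.inr w) 1 with hα
  set β : V ⊕ V →₀ ℕ := Finsupp.single (Sum.inl w) 1 + Finsupp.single (Sum.inr v) 1 with hβ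
  rw [← ker_toQuot, RingHom.mem_ker, edge_binomial_eq, map_mul, map_sub, toQuot_monomial,
    toQuot_monomial, sub_mul, sub_eq_zero] at hg
  rw [← ker_toQuot, RingHom.mem_ker]
  set q := toQuot K G g with hq
  have hα' : ∀ c, vertexDegree α c ≠ 0 → c = v ∨ c = w := by
    intro c hc
    rw [hα, vertexDegree_pair] at hc
    by_contra! h
    simp [h.1.symm, h.2.symm] at hc
  have injα : ∀ x y : (swapCon G).Quotient, (α : (swapCon G).Quotient) + x = α + y → x = y := by
    intro x y
    induction x, y using AddCon.induction_on₂ with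
    | _ x y =>
    intro h
    rw [← AddCon.coe_add, ← AddCon.coe_add, (swapCon G).eq, add_comm α, add_comm α] at h
    exact (swapCon G).eq.2 (swapCon_of_add hv hw hadj hα' h)
  -- The total `x`-degree on the connected component of `v`.
  set P : Finset V := Finset.univ.filter (G.Reachable v) with hP
  have hPc : ∀ m, ClosedOn G m P := by
    intro m a b hab _ _ ha
    simp only [hP, Finset.mem_filter, Finset.mem_univ, true_and] at ha ⊢
    exact ha.trans hab.reachable
  set ω : (swapCon G).Quotient → ℕ := fun x => ∑ a ∈ P, (Quotient.out x : V ⊕ V →₀ ℕ) (Sum.inl a)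
  have hω : ∀ m : V ⊕ V →₀ ℕ, ω m = ∑ a ∈ P, m (Sum.inl a) := by
    intro m
    exact (swapCon_iff.1 (Quotient.exact
      (Quotient.out_eq (m : (swapCon G).Quotient)))).2 P (hPc _)
  have hωαβ : ∀ x y : (swapCon G).Quotient, (α : (swapCon G).Quotient) + x = β + y →
      ω y = ω x + 1 := by
    intro x y
    induction x, y using AddCon.induction_on₂ with
    | _ x y =>
    intro h
    rw [← AddCon.coe_add, ← AddCon.coe_add, (swapCon G).eq] at h
    have h1 := (swapCon_iff.1 h).2 P (hPc _)
    simp only [Finsupp.add_apply α, Finsupp.add_apply β, Finset.sum_add_distrib] at h1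
    rw [hα, hβ, sum_inl_pair, sum_inl_pair,
      if_pos (by simp [hP]), if_neg (by simpa [hP] using hvw)] at h1
    rw [hω, hω]
    omega
  by_contra hq0
  have hne : q.coeff.support.Nonempty := by
    rw [Finsupp.support_nonempty_iff]
    intro h0
    exact hq0 (by ext x; simp [h0])
  -- A term of maximal `x`-degree on `P`, multiplied by `α`, would have to be a term multiplied by `β`.
  obtain ⟨x, hx, hmax⟩ := Finset.exists_max_image q.coeff.support ω hne
  have h1 : (AddMonoidAlgebra.single (α : (swapCon G).Quotient) (1 : K) * q).coeff (α + x) =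
      q.coeff x := by
    rw [AddMonoidAlgebra.coeff_single_mul_eq_mul_coeff (m₂ := x), one_mul]
    intro y _
    exact ⟨injα y x, fun h => h ▸ rfl⟩
  rw [hg] at h1
  have h2 : α + x ∈ (AddMonoidAlgebra.single (β : (swapCon G).Quotient) (1 : K) * q).coeff.support :=
    Finsupp.mem_support_iff.2 (h1 ▸ Finsupp.mem_support_iff.1 hx)
  obtain ⟨y, hy, hyx⟩ := Finset.mem_image.1
    (AddMonoidAlgebra.support_coeff_single_mul_subset q 1 _ h2)
  have := hmax y hy
  have := hωαβ x y hyx.symm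
  omega

end BinomialEdge

/-! ### Minimal resolutions of cyclic modules -/

namespace BinomialEdge

open MvPolynomial

/-- The homogeneous elements of degree `n` in the shifted polynomial ring `S(-m)`: homogeneous
polynomials of degree `n - m`, where only `0` qualifies if `n < m`. -/
def shiftedHomogeneous (K : Type*) [Field K] (σ : Type*) (m n : ℕ) :
    Submodule K (MvPolynomial σ K) where
  carrier := {p | ∀ s, coeff s p ≠ 0 → m + s.degree = n}
  zero_mem' := by simp
  add_mem' := by
    intro p q hp hq s hs
    rw [coeff_add] at hs
    by_cases h : coeff s p = 0
    · exact hq s (by simpa [h] using hs)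
    · exact hp s h
  smul_mem' := by
    intro c p hp s hs
    rw [coeff_smul, smul_eq_mul] at hs
    exact hp s (right_ne_zero_of_mul hs)

variable {K : Type*} [Field K] {σ : Type*}

lemma mem_shiftedHomogeneous {m n : ℕ} {p : MvPolynomial σ K} :
    p ∈ shiftedHomogeneous K σ m n ↔ ∀ s, coeff s p ≠ 0 → m + s.degree = n := Iff.rfl

lemma isHomogeneous_iff_degree {p : MvPolynomial σ K} {k : ℕ} :
    p.IsHomogeneous k ↔ ∀ s, coeff s p ≠ 0 → s.degree = k := by
  rw [IsHomogeneous, IsWeightedHomogeneous, Finsupp.degree_eq_weight_one]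
  rfl

lemma mem_shiftedHomogeneous_add {m k : ℕ} {p : MvPolynomial σ K} :
    p ∈ shiftedHomogeneous K σ m (m + k) ↔ p.IsHomogeneous k := by
  rw [mem_shiftedHomogeneous, isHomogeneous_iff_degree]
  simp

lemma mem_shiftedHomogeneous_iff {m n : ℕ} {p : MvPolynomial σ K} :
    p ∈ shiftedHomogeneous K σ m n ↔ p = 0 ∨ ∃ k, m + k = n ∧ p.IsHomogeneous k := by
  constructor
  · intro h
    by_cases hp : p = 0
    · exact Or.inl hp
    · obtain ⟨s, hs⟩ := MvPolynomial.ne_zero_iff.1 hp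
      refine Or.inr ⟨s.degree, h s hs, ?_⟩
      rw [← mem_shiftedHomogeneous_add (m := m), h s hs]
      exact h
  · rintro (rfl | ⟨k, rfl, hk⟩)
    · exact zero_mem _
    · exact mem_shiftedHomogeneous_add.2 hk

lemma mul_mem_shiftedHomogeneous {l m n : ℕ} {p q : MvPolynomial σ K}
    (hp : p ∈ shiftedHomogeneous K σ l m) (hq : q ∈ shiftedHomogeneous K σ m n) :
    p * q ∈ shiftedHomogeneous K σ l n := by
  rw [mem_shiftedHomogeneous_iff] at hp hq
  rcases hp with rfl | ⟨i, rfl, hi⟩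
  · rw [zero_mul]; exact zero_mem _
  rcases hq with rfl | ⟨j, rfl, hj⟩
  · rw [mul_zero]; exact zero_mem _
  rw [add_assoc, mem_shiftedHomogeneous_add]
  exact hi.mul hj

lemma shiftedHomogeneous_add_left {m n k : ℕ} {p : MvPolynomial σ K}
    (hp : p ∈ shiftedHomogeneous K σ m n) : p ∈ shiftedHomogeneous K σ (m + k) (n + k) := by
  intro s hs
  have := hp s hs
  omega

/-- An element of `S(-m)` of degree at most `m` without constant term vanishes. -/
lemma eq_zero_of_mem_of_constantCoeff {m n : ℕ} {p : MvPolynomial σ K}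
    (hp : p ∈ shiftedHomogeneous K σ m n) (h0 : constantCoeff p = 0) (hmn : n ≤ m) : p = 0 := by
  ext s
  by_contra hs
  rw [coeff_zero] at hs
  have h1 := hp s hs
  have h2 : s = 0 := by
    rw [← Finsupp.degree_eq_zero_iff]; omega
  subst h2
  exact hs h0

/-- A minimal graded free resolution of the cyclic module `S / J`. The free modules of all
homological degrees are collected in one free module with basis `I`, on which the differential
acts as one endomorphism; `hdeg` and `deg` are the homological and the internal degrees of the
basis elements. The only basis element of homological degree zero is `o`, which maps to `1` in
`S / J`. -/
structure CyclicResolution (J : Ideal (MvPolynomial σ K)) (I : Type*) where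
  /-- the homological degree of a basis element -/
  hdeg : I → ℕ
  /-- the internal degree of a basis element -/
  deg : I → ℕ
  /-- the differential -/
  d : (I →₀ MvPolynomial σ K) →ₗ[MvPolynomial σ K] (I →₀ MvPolynomial σ K)
  /-- the generator of the resolved module -/
  o : I
  deg_o : deg o = 0
  hdeg_eq_zero : ∀ a, hdeg a = 0 ↔ a = o
  hdeg_d : ∀ a b, d (Finsupp.single a 1) b ≠ 0 → hdeg b + 1 = hdeg a
  deg_d : ∀ a b, d (Finsupp.single a 1) b ∈ shiftedHomogeneous K σ (deg b) (deg a)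
  minimal : ∀ a b, constantCoeff (d (Finsupp.single a 1) b) = 0
  d_d : ∀ z, d (d z) = 0
  /-- exactness in positive homological degrees: a cycle is a boundary up to its component of
  homological degree zero -/
  exact : ∀ z, d z = 0 → ∃ w r, z = d w + Finsupp.single o r
  /-- the boundaries of homological degree zero are the elements of `J` -/
  mem_iff : ∀ r, (∃ w, d w = Finsupp.single o r) ↔ r ∈ J
  /-- the free modules have finite rank -/
  finite : ∀ n, {a | hdeg a = n}.Finite

namespace CyclicResolution

variable {J : Ideal (MvPolynomial σ K)} {I : Type*} (F : CyclicResolution J I)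

lemma d_single (a : I) (r : MvPolynomial σ K) :
    F.d (Finsupp.single a r) = r • F.d (Finsupp.single a 1) := by
  rw [← map_smul, Finsupp.smul_single, smul_eq_mul, mul_one]

lemma hdeg_o : F.hdeg F.o = 0 := (F.hdeg_eq_zero _).2 rfl

lemma d_o (r : MvPolynomial σ K) : F.d (Finsupp.single F.o r) = 0 := by
  rw [d_single]
  ext1 b
  by_contra h
  have := F.hdeg_d F.o b (fun h0 => h (by simp [h0]))
  rw [F.hdeg_o] at this
  omega

lemma d_of_hdeg_one {a : I} (ha : F.hdeg a = 1) :
    F.d (Finsupp.single a 1) = Finsupp.single F.o (F.d (Finsupp.single a 1) F.o) := by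
  classical
  ext1 b
  rw [Finsupp.single_apply]
  split_ifs with h
  · rw [h]
  · by_contra h0
    have := F.hdeg_d a b h0
    exact h ((F.hdeg_eq_zero b).1 (by omega)).symm

lemma d_apply_o_mem (w : I →₀ MvPolynomial σ K) : F.d w F.o ∈ J := by
  induction w using Finsupp.induction_linear with
  | zero => simp
  | add f g hf hg => rw [map_add, Finsupp.add_apply]; exact J.add_mem hf hg
  | single a r =>
    rw [F.d_single, Finsupp.smul_apply, smul_eq_mul]
    refine J.mul_mem_left _ ?_
    by_cases h : F.d (Finsupp.single a 1) F.o = 0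
    · rw [h]; exact J.zero_mem
    · have h1 := F.hdeg_d a F.o h
      rw [F.hdeg_o, zero_add] at h1
      exact (F.mem_iff _).1 ⟨_, F.d_of_hdeg_one h1.symm⟩

lemma constantCoeff_d (w : I →₀ MvPolynomial σ K) (b : I) : constantCoeff (F.d w b) = 0 := by
  induction w using Finsupp.induction_linear with
  | zero => simp
  | add f g hf hg => rw [map_add, Finsupp.add_apply, map_add, hf, hg, add_zero]
  | single a r => rw [F.d_single, Finsupp.smul_apply, smul_eq_mul, map_mul, F.minimal, mul_zero]

lemma filter_d (n : ℕ) (w : I →₀ MvPolynomial σ K) :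
    (F.d w).filter (fun a => F.hdeg a = n) = F.d (w.filter fun a => F.hdeg a = n + 1) := by
  classical
  induction w using Finsupp.induction_linear with
  | zero => rw [map_zero, Finsupp.filter_zero, Finsupp.filter_zero, map_zero]
  | add f g hf hg => rw [map_add, Finsupp.filter_add, hf, hg, ← map_add, ← Finsupp.filter_add]
  | single a r =>
    ext1 b
    rw [Finsupp.filter_apply]
    by_cases h0 : F.d (Finsupp.single a 1) b = 0
    · have h1 : F.d (Finsupp.single a r) b = 0 := by
        rw [F.d_single, Finsupp.smul_apply, h0, smul_zero]
      by_cases ha : F.hdeg a = n + 1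
      · rw [Finsupp.filter_single_of_pos (p := fun a => F.hdeg a = n + 1) ha, h1, ite_self]
      · rw [Finsupp.filter_single_of_neg (p := fun a => F.hdeg a = n + 1) ha, h1, ite_self,
          map_zero, Finsupp.zero_apply]
    · have h1 := F.hdeg_d a b h0
      by_cases ha : F.hdeg a = n + 1
      · rw [Finsupp.filter_single_of_pos (p := fun a => F.hdeg a = n + 1) ha, if_pos (by omega)]
      · rw [Finsupp.filter_single_of_neg (p := fun a => F.hdeg a = n + 1) ha, if_neg (by omega),
          map_zero, Finsupp.zero_apply]

/-- The sign involution, multiplication by `(-1) ^ i` in homological degree `i`. -/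
noncomputable def sign : (I →₀ MvPolynomial σ K) →ₗ[MvPolynomial σ K] (I →₀ MvPolynomial σ K) :=
  Finsupp.linearCombination _ fun a => Finsupp.single a ((-1) ^ F.hdeg a)

lemma sign_single (a : I) (r : MvPolynomial σ K) :
    F.sign (Finsupp.single a r) = Finsupp.single a ((-1) ^ F.hdeg a * r) := by
  rw [sign, Finsupp.linearCombination_single, Finsupp.smul_single, smul_eq_mul, mul_comm]

lemma sign_apply (z : I →₀ MvPolynomial σ K) (b : I) :
    F.sign z b = (-1) ^ F.hdeg b * z b := by
  classical
  induction z using Finsupp.induction_linear with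
  | zero => simp
  | add f g hf hg => rw [map_add, Finsupp.add_apply, Finsupp.add_apply, hf, hg, mul_add]
  | single a r =>
    rw [sign_single, Finsupp.single_apply, Finsupp.single_apply]
    split_ifs with h
    · rw [h]
    · rw [mul_zero]

lemma sign_sign (z : I →₀ MvPolynomial σ K) : F.sign (F.sign z) = z := by
  ext1 b
  rw [sign_apply, sign_apply, ← mul_assoc, ← mul_pow]
  simp

lemma d_sign (z : I →₀ MvPolynomial σ K) : F.d (F.sign z) = - F.sign (F.d z) := by
  induction z using Finsupp.induction_linear with
  | zero => simp
  | add f g hf hg => rw [map_add, map_add, map_add, map_add, hf, hg, neg_add]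
  | single a r =>
    ext1 b
    rw [sign_single, F.d_single, F.d_single a r, Finsupp.neg_apply, sign_apply, Finsupp.smul_apply,
      Finsupp.smul_apply, smul_eq_mul, smul_eq_mul]
    by_cases h0 : F.d (Finsupp.single a 1) b = 0
    · rw [h0]; ring
    · rw [← F.hdeg_d a b h0, pow_succ]; ring

lemma single_mem_of_mem {r : MvPolynomial σ K} (hr : r ∈ J) :
    ∃ w, F.d w = Finsupp.single F.o r := (F.mem_iff r).2 hr

end CyclicResolution

/-- `r` is the Castelnuovo-Mumford regularity of `S / J`, as computed by some minimal graded free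
resolution. -/
def HasRegularity (J : Ideal (MvPolynomial σ K)) (r : EReal) : Prop :=
  ∃ (I : Type) (F : CyclicResolution J I),
    r = ⨆ a, (((F.deg a : ℝ) - (F.hdeg a : ℝ) : ℝ) : EReal)

/-! ### Adding a nonzerodivisor -/

namespace CyclicResolution

variable {J : Ideal (MvPolynomial σ K)} {I : Type*} (F : CyclicResolution J I)

/-- The differential of the mapping cone of multiplication by `f`. -/
noncomputable def coneD (f : MvPolynomial σ K) :
    (I ⊕ I →₀ MvPolynomial σ K) →ₗ[MvPolynomial σ K] (I ⊕ I →₀ MvPolynomial σ K) :=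
  (Finsupp.sumFinsuppLEquivProdFinsupp (MvPolynomial σ K)).symm.toLinearMap ∘ₗ
    ((F.d ∘ₗ LinearMap.fst _ _ _ + f • F.sign ∘ₗ LinearMap.snd _ _ _).prod
      (F.d ∘ₗ LinearMap.snd _ _ _)) ∘ₗ
    (Finsupp.sumFinsuppLEquivProdFinsupp (MvPolynomial σ K)).toLinearMap

/-- A pair of vectors as a vector indexed by the disjoint union. -/
noncomputable abbrev pair (z w : I →₀ MvPolynomial σ K) : I ⊕ I →₀ MvPolynomial σ K :=
  (Finsupp.sumFinsuppLEquivProdFinsupp (MvPolynomial σ K)).symm (z, w)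

lemma coneD_pair (f : MvPolynomial σ K) (z w : I →₀ MvPolynomial σ K) :
    F.coneD f (pair z w) = pair (F.d z + f • F.sign w) (F.d w) := by
  simp [coneD, pair]

lemma exists_pair (x : I ⊕ I →₀ MvPolynomial σ K) : ∃ z w, x = pair z w :=
  ⟨_, _, ((Finsupp.sumFinsuppLEquivProdFinsupp (MvPolynomial σ K)).symm_apply_apply x).symm⟩

lemma pair_inj {z w z' w' : I →₀ MvPolynomial σ K} : pair z w = pair z' w' ↔ z = z' ∧ w = w' := by
  rw [pair, pair, EmbeddingLike.apply_eq_iff_eq, Prod.mk.injEq]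

lemma pair_single_inl (a : I) (r : MvPolynomial σ K) :
    pair (Finsupp.single a r) 0 = Finsupp.single (Sum.inl a) r := by
  classical
  ext1 b
  rcases b with b | b <;> simp [pair, Finsupp.single_apply]

lemma pair_single_inr (a : I) (r : MvPolynomial σ K) :
    pair 0 (Finsupp.single a r) = Finsupp.single (Sum.inr a) r := by
  classical
  ext1 b
  rcases b with b | b <;> simp [pair, Finsupp.single_apply]

lemma coneD_inl (f : MvPolynomial σ K) (a : I) :
    F.coneD f (Finsupp.single (Sum.inl a) 1) = pair (F.d (Finsupp.single a 1)) 0 := by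
  rw [← pair_single_inl, coneD_pair, map_zero, map_zero, smul_zero, add_zero]

lemma coneD_inr (f : MvPolynomial σ K) (a : I) :
    F.coneD f (Finsupp.single (Sum.inr a) 1) =
      pair (Finsupp.single a (f * (-1) ^ F.hdeg a)) (F.d (Finsupp.single a 1)) := by
  rw [← pair_single_inr, coneD_pair, map_zero, zero_add, sign_single, mul_one,
    Finsupp.smul_single, smul_eq_mul]

/-- The mapping cone of multiplication by `f`, a homogeneous nonzerodivisor on `S / J` of positive
degree, is a minimal resolution of `S / (J + (f))`. -/
noncomputable def cone {f : MvPolynomial σ K} {k : ℕ} (hf : f.IsHomogeneous k)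
    (hf0 : constantCoeff f = 0) (hreg : ∀ g, f * g ∈ J → g ∈ J) :
    CyclicResolution (J ⊔ Ideal.span {f}) (I ⊕ I) where
  hdeg := Sum.elim F.hdeg fun a => F.hdeg a + 1
  deg := Sum.elim F.deg fun a => F.deg a + k
  d := F.coneD f
  o := Sum.inl F.o
  deg_o := F.deg_o
  hdeg_eq_zero := by
    rintro (a | a)
    · simp [F.hdeg_eq_zero]
    · simp
  hdeg_d := by
    classical
    rintro (a | a) (b | b) h
    · rw [coneD_inl] at h; exact F.hdeg_d a b (by simpa [pair] using h)
    · rw [coneD_inl] at h; simp [pair] at h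
    · rw [coneD_inr] at h
      simp only [pair, Finsupp.sumFinsuppLEquivProdFinsupp_symm_inl, Finsupp.single_apply,
        ne_eq, ite_eq_right_iff, not_forall] at h
      simp [h.1]
    · rw [coneD_inr] at h
      have := F.hdeg_d a b (by simpa [pair] using h)
      simp [this]
  deg_d := by
    classical
    rintro (a | a) (b | b)
    · rw [coneD_inl]; simpa [pair] using F.deg_d a b
    · rw [coneD_inl]; simp [pair]
    · rw [coneD_inr]
      simp only [pair, Finsupp.sumFinsuppLEquivProdFinsupp_symm_inl, Finsupp.single_apply,
        Sum.elim_inl, Sum.elim_inr]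
      split_ifs with h
      · subst h
        rw [mem_shiftedHomogeneous_add]
        rcases neg_one_pow_eq_or (MvPolynomial σ K) (F.hdeg a) with h | h
        · simpa [h] using hf
        · simpa [h] using hf.neg
      · exact zero_mem _
    · rw [coneD_inr]
      simpa [pair] using shiftedHomogeneous_add_left (F.deg_d a b)
  minimal := by
    classical
    rintro (a | a) (b | b)
    · rw [coneD_inl]; simpa [pair] using F.minimal a b
    · rw [coneD_inl]; simp [pair]
    · rw [coneD_inr]
      simp only [pair, Finsupp.sumFinsuppLEquivProdFinsupp_symm_inl, Finsupp.single_apply]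
      split_ifs
      · rw [map_mul, hf0, zero_mul]
      · exact map_zero _
    · rw [coneD_inr]; simpa [pair] using F.minimal a b
  d_d := by
    intro x
    obtain ⟨z, w, rfl⟩ := exists_pair x
    rw [coneD_pair, coneD_pair, map_add, F.d_d, F.d_d, map_smul, d_sign]
    simp
  exact := by
    intro x hx
    obtain ⟨z, w, rfl⟩ := exists_pair x
    rw [coneD_pair, ← map_zero (Finsupp.sumFinsuppLEquivProdFinsupp (MvPolynomial σ K)).symm,
      ← Prod.mk_zero_zero, pair_inj] at hx
    obtain ⟨hz, hw⟩ := hx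
    -- `w` is a boundary up to `r` in degree zero, and `f * r` is a boundary because of `hz`.
    obtain ⟨w1, r, rfl⟩ := F.exact w hw
    have hs : F.sign (Finsupp.single F.o r) = Finsupp.single F.o r := by
      rw [sign_single, F.hdeg_o, pow_zero, one_mul]
    rw [map_add, hs, smul_add, Finsupp.smul_single, smul_eq_mul] at hz
    have hfr : f * r ∈ J := (F.mem_iff _).1 ⟨f • F.sign w1 - z, by
      rw [map_sub, map_smul, d_sign, smul_neg, ← sub_eq_zero, ← neg_eq_zero, ← hz]
      abel⟩
    obtain ⟨w2, hw2⟩ := F.single_mem_of_mem (hreg r hfr)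
    obtain ⟨z1, s, hz1⟩ := F.exact (z - f • F.sign (w1 + w2)) (by
      rw [map_sub, map_smul, d_sign, map_add, map_add, hw2, hs, ← hz, smul_neg, smul_add,
        Finsupp.smul_single, smul_eq_mul]
      abel)
    refine ⟨pair z1 (w1 + w2), s, ?_⟩
    rw [coneD_pair, ← pair_single_inl, ← map_add, Prod.mk_add_mk, pair_inj]
    refine ⟨?_, by rw [map_add, hw2, add_zero]⟩
    rw [add_right_comm, ← hz1, sub_add_cancel]
  mem_iff := by
    intro r
    rw [Submodule.mem_sup]
    constructor
    · rintro ⟨x, hx⟩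
      obtain ⟨z, w, rfl⟩ := exists_pair x
      rw [coneD_pair, ← pair_single_inl, pair_inj] at hx
      obtain ⟨hz, hw⟩ := hx
      obtain ⟨u, s, rfl⟩ := F.exact w hw
      have := DFunLike.congr_fun hz F.o
      rw [Finsupp.add_apply, Finsupp.single_eq_same, Finsupp.smul_apply, sign_apply, F.hdeg_o,
        pow_zero, one_mul, smul_eq_mul] at this
      exact ⟨_, F.d_apply_o_mem z, _, Ideal.mul_mem_right _ _ (Ideal.mem_span_singleton_self f),
        this⟩
    · rintro ⟨j, hj, g, hg, rfl⟩
      obtain ⟨s, rfl⟩ := Ideal.mem_span_singleton'.1 hg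
      obtain ⟨w, hw⟩ := F.single_mem_of_mem hj
      refine ⟨pair w (Finsupp.single F.o s), ?_⟩
      rw [coneD_pair, F.d_o, sign_single, F.hdeg_o, pow_zero, one_mul, hw, Finsupp.smul_single,
        smul_eq_mul, ← Finsupp.single_add, pair_single_inl, mul_comm f]
  finite := by
    intro n
    refine (((F.finite n).image Sum.inl).union ((F.finite (n - 1)).image Sum.inr)).subset ?_
    rintro (a | a) h
    · exact Or.inl ⟨a, h, rfl⟩
    · exact Or.inr ⟨a, by simp only [Set.mem_ofPred_eq, Sum.elim_inr] at h ⊢; omega, rfl⟩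

end CyclicResolution

lemma ereal_iSup_prod_add {α β : Type*} (u : α → EReal) (v : β → EReal) :
    (⨆ p : α × β, (u p.1 + v p.2)) = (⨆ a, u a) + ⨆ b, v b := by
  refine le_antisymm (iSup_le fun p => add_le_add (le_iSup u p.1) (le_iSup v p.2)) ?_
  refine EReal.add_le_of_forall_lt fun a ha b hb => ?_
  obtain ⟨i, hi⟩ := lt_iSup_iff.1 ha
  obtain ⟨j, hj⟩ := lt_iSup_iff.1 hb
  exact (add_le_add hi.le hj.le).trans (le_iSup (fun p : α × β => u p.1 + v p.2) (i, j))

lemma ereal_iSup_add_const {α : Type*} (u : α → EReal) (c : EReal) :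
    (⨆ a, u a) + c = ⨆ a, (u a + c) := by
  have h := ereal_iSup_prod_add u fun _ : Unit => c
  rw [ciSup_const, iSup_prod] at h
  simpa using h.symm

/-- Dividing out a homogeneous nonzerodivisor of degree two raises the regularity by one. -/
theorem HasRegularity.sup_span_singleton {J : Ideal (MvPolynomial σ K)} {r : EReal}
    (h : HasRegularity J r) {f : MvPolynomial σ K} (hf : f.IsHomogeneous 2)
    (hreg : ∀ g, f * g ∈ J → g ∈ J) : HasRegularity (J ⊔ Ideal.span {f}) (r + 1) := by
  obtain ⟨I, F, rfl⟩ := h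
  have hf0 : constantCoeff f = 0 := by
    rw [constantCoeff_eq]
    exact hf.coeff_eq_zero (by simp)
  refine ⟨I ⊕ I, F.cone hf hf0 hreg, ?_⟩
  rw [iSup_sum]
  have h1 : ∀ a, (((((F.cone hf hf0 hreg).deg (Sum.inr a) : ℕ) : ℝ) -
      (((F.cone hf hf0 hreg).hdeg (Sum.inr a) : ℕ) : ℝ) : ℝ) : EReal) =
      (((F.deg a : ℝ) - (F.hdeg a : ℝ) : ℝ) : EReal) + 1 := by
    intro a
    rw [← EReal.coe_one, ← EReal.coe_add]
    simp only [CyclicResolution.cone, Sum.elim_inr]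
    congr 1
    push_cast
    ring
  simp only [h1]
  rw [ereal_iSup_add_const, eq_comm, sup_eq_right]
  refine iSup_mono fun a => ?_
  simp only [CyclicResolution.cone, Sum.elim_inl]
  exact le_add_of_nonneg_right zero_le_one

end BinomialEdge

/-! ### Tensor products over disjoint sets of variables -/

namespace BinomialEdge

open MvPolynomial TensorProduct

variable {K : Type*} [Field K] {σ τ υ : Type*}

lemma rename_mem_shiftedHomogeneous (f : σ → υ) {m n : ℕ} {p : MvPolynomial σ K}
    (hp : p ∈ shiftedHomogeneous K σ m n) : rename f p ∈ shiftedHomogeneous K υ m n := by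
  rw [mem_shiftedHomogeneous_iff] at hp ⊢
  rcases hp with rfl | ⟨k, hk, h⟩
  · exact Or.inl (map_zero _)
  · exact Or.inr ⟨k, hk, h.rename_isHomogeneous⟩

variable (K) in
/-- The polynomial ring in the variables `σ ⊕ τ ≃ υ` as a tensor product over the field. -/
noncomputable def polyTensorEquiv (e : σ ⊕ τ ≃ υ) :
    MvPolynomial σ K ⊗[K] MvPolynomial τ K ≃ₐ[K] MvPolynomial υ K :=
  (tensorEquivSum K σ τ K).trans (renameEquiv K e)

lemma polyTensorEquiv_tmul (e : σ ⊕ τ ≃ υ) (p : MvPolynomial σ K) (q : MvPolynomial τ K) :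
    polyTensorEquiv K e (p ⊗ₜ q) = rename (e ∘ Sum.inl) p * rename (e ∘ Sum.inr) q := by
  have h1 : (polyTensorEquiv K e).toAlgHom.comp Algebra.TensorProduct.includeLeft =
      rename (e ∘ Sum.inl) := by
    ext i; simp [polyTensorEquiv]
  have h2 : (polyTensorEquiv K e).toAlgHom.comp Algebra.TensorProduct.includeRight =
      rename (e ∘ Sum.inr) := by
    ext i; simp [polyTensorEquiv]
  rw [← h1, ← h2]
  change _ = polyTensorEquiv K e (p ⊗ₜ 1) * polyTensorEquiv K e (1 ⊗ₜ q)
  rw [← map_mul, Algebra.TensorProduct.tmul_mul_tmul, mul_one, one_mul]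

variable (K) in
/-- The tensor product over the field of two free modules over polynomial rings, as a free module
over the polynomial ring in all the variables. -/
noncomputable def freeTensorEquiv (e : σ ⊕ τ ≃ υ) (I L : Type*) :
    (I →₀ MvPolynomial σ K) ⊗[K] (L →₀ MvPolynomial τ K) ≃ₗ[K] (I × L →₀ MvPolynomial υ K) :=
  (finsuppTensorFinsupp K K (MvPolynomial σ K) (MvPolynomial τ K) I L).trans
    (Finsupp.mapRange.linearEquiv (polyTensorEquiv K e).toLinearEquiv)

section

variable (e : σ ⊕ τ ≃ υ) {I L : Type*}

lemma freeTensorEquiv_tmul_apply (x : I →₀ MvPolynomial σ K) (y : L →₀ MvPolynomial τ K)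
    (p : I × L) :
    freeTensorEquiv K e I L (x ⊗ₜ y) p =
      rename (e ∘ Sum.inl) (x p.1) * rename (e ∘ Sum.inr) (y p.2) := by
  obtain ⟨i, l⟩ := p
  rw [← polyTensorEquiv_tmul, freeTensorEquiv, LinearEquiv.trans_apply,
    Finsupp.mapRange.linearEquiv_apply, Finsupp.mapRange_apply, finsuppTensorFinsupp_apply]
  rfl

lemma freeTensorEquiv_single (a : I) (r : MvPolynomial σ K) (b : L) (q : MvPolynomial τ K) :
    freeTensorEquiv K e I L (Finsupp.single a r ⊗ₜ Finsupp.single b q) =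
      Finsupp.single (a, b) (rename (e ∘ Sum.inl) r * rename (e ∘ Sum.inr) q) := by
  rw [← polyTensorEquiv_tmul, freeTensorEquiv, LinearEquiv.trans_apply,
    finsuppTensorFinsupp_single, Finsupp.mapRange.linearEquiv_apply, Finsupp.mapRange_single]
  rfl

lemma freeTensorEquiv_smul (r : MvPolynomial σ K) (q : MvPolynomial τ K)
    (x : I →₀ MvPolynomial σ K) (y : L →₀ MvPolynomial τ K) :
    freeTensorEquiv K e I L ((r • x) ⊗ₜ (q • y)) =
      (rename (e ∘ Sum.inl) r * rename (e ∘ Sum.inr) q) • freeTensorEquiv K e I L (x ⊗ₜ y) := by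
  ext1 p
  rw [Finsupp.smul_apply, freeTensorEquiv_tmul_apply, freeTensorEquiv_tmul_apply,
    Finsupp.smul_apply, Finsupp.smul_apply, smul_eq_mul, smul_eq_mul, smul_eq_mul, map_mul, map_mul]
  ring

end

namespace CyclicResolution

variable {J₁ : Ideal (MvPolynomial σ K)} {J₂ : Ideal (MvPolynomial τ K)} {I L : Type*}
  (F : CyclicResolution J₁ I) (G : CyclicResolution J₂ L)

/-- A `K`-linear homotopy `s` from the identity to a map `p` into homological degree zero: a
resolution is contractible over the field onto a complement of `J₁` in that degree. -/
lemma exists_contraction : ∃ s p : (I →₀ MvPolynomial σ K) →ₗ[K] (I →₀ MvPolynomial σ K),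
    (∀ z, p z = z - F.d (s z) - s (F.d z)) ∧ ∀ z, ∃ r, p z = Finsupp.single F.o r := by
  classical
  set dK : (I →₀ MvPolynomial σ K) →ₗ[K] (I →₀ MvPolynomial σ K) := F.d.restrictScalars K with hdK
  obtain ⟨q₀, hq₀⟩ := dK.range.exists_isCompl
  obtain ⟨ρ₀, hρ₀⟩ := (J₁.restrictScalars K).exists_isCompl
  let q := dK.range.projectionOnto q₀ hq₀
  let ρ := (J₁.restrictScalars K).projectionOnto ρ₀ hρ₀
  have : Module.Free K dK.range := Module.Free.of_divisionRing K dK.range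
  obtain ⟨g, hg⟩ := dK.rangeRestrict.exists_rightInverse_of_surjective dK.range_rangeRestrict
  have hg' : ∀ b, F.d (g b) = b := fun b => congrArg Subtype.val (DFunLike.congr_fun hg b)
  have hρ : ∀ r ∈ J₁, (ρ r : MvPolynomial σ K) = r := fun r hr =>
    congrArg Subtype.val (Submodule.projectionOnto_apply_left hρ₀ ⟨r, hr⟩)
  have hq : ∀ b ∈ dK.range, (q b : I →₀ MvPolynomial σ K) = b := fun b hb =>
    congrArg Subtype.val (Submodule.projectionOnto_apply_left hq₀ ⟨b, hb⟩)
  have hsingle : ∀ r : MvPolynomial σ K, r ∈ J₁ → Finsupp.single F.o r ∈ dK.range := by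
    intro r hr
    obtain ⟨w, hw⟩ := F.single_mem_of_mem hr
    exact ⟨w, hw⟩
  -- A projection onto the boundaries that respects the summand of homological degree zero.
  let ev : (I →₀ MvPolynomial σ K) →ₗ[K] MvPolynomial σ K :=
    (Finsupp.lapply F.o : (I →₀ MvPolynomial σ K) →ₗ[MvPolynomial σ K] _).restrictScalars K
  let sg : MvPolynomial σ K →ₗ[K] (I →₀ MvPolynomial σ K) :=
    (Finsupp.lsingle F.o : _ →ₗ[MvPolynomial σ K] (I →₀ MvPolynomial σ K)).restrictScalars K
  let Q : (I →₀ MvPolynomial σ K) →ₗ[K] (I →₀ MvPolynomial σ K) :=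
    dK.range.subtype ∘ₗ q ∘ₗ (LinearMap.id - sg ∘ₗ ev) +
      sg ∘ₗ (J₁.restrictScalars K).subtype ∘ₗ ρ ∘ₗ ev
  have hQ : ∀ z, Q z = q (z - Finsupp.single F.o (z F.o)) + Finsupp.single F.o (ρ (z F.o)).1 :=
    fun z => rfl
  have hQmem : ∀ z, Q z ∈ dK.range := by
    intro z
    rw [hQ]
    exact add_mem (q _).2 (hsingle _ (ρ _).2)
  have hQb : ∀ w, Q (F.d w) = F.d w := by
    intro w
    have h1 : F.d w F.o ∈ J₁ := F.d_apply_o_mem w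
    have h2 : F.d w ∈ dK.range := ⟨w, rfl⟩
    rw [hQ, hρ _ h1, hq _ (sub_mem h2 (hsingle _ h1)), sub_add_cancel]
  have hQo : ∀ r, Q (Finsupp.single F.o r) = Finsupp.single F.o (ρ r).1 := by
    intro r
    rw [hQ, Finsupp.single_eq_same, sub_self, map_zero, ZeroMemClass.coe_zero, zero_add]
  let gQ : (I →₀ MvPolynomial σ K) →ₗ[K] (I →₀ MvPolynomial σ K) := g ∘ₗ Q.codRestrict _ hQmem
  have hgQ : ∀ z, F.d (gQ z) = Q z := fun z => hg' _
  refine ⟨gQ ∘ₗ (LinearMap.id - gQ ∘ₗ dK),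
    LinearMap.id - dK ∘ₗ (gQ ∘ₗ (LinearMap.id - gQ ∘ₗ dK)) -
      (gQ ∘ₗ (LinearMap.id - gQ ∘ₗ dK)) ∘ₗ dK, fun z => rfl, fun z => ?_⟩
  have e1 : F.d (z - gQ (F.d z)) = 0 := by
    rw [map_sub, hgQ, hQb, sub_self]
  obtain ⟨w, r, hw⟩ := F.exact _ e1
  refine ⟨r - (ρ r).1, ?_⟩
  change z - F.d (gQ (z - gQ (F.d z))) - gQ (F.d z - gQ (F.d (F.d z))) = _
  rw [F.d_d, map_zero, sub_zero, sub_right_comm, hgQ, hw, map_add, hQb, hQo,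
    Finsupp.single_sub]
  exact add_sub_add_left_eq_sub _ _ _

/-- The differential of the tensor product complex. -/
noncomputable def tensorDiff :
    (I →₀ MvPolynomial σ K) ⊗[K] (L →₀ MvPolynomial τ K) →ₗ[K]
      (I →₀ MvPolynomial σ K) ⊗[K] (L →₀ MvPolynomial τ K) :=
  TensorProduct.map (F.d.restrictScalars K) LinearMap.id +
    TensorProduct.map (F.sign.restrictScalars K) (G.d.restrictScalars K)

lemma tensorDiff_tmul (x : I →₀ MvPolynomial σ K) (y : L →₀ MvPolynomial τ K) :
    F.tensorDiff G (x ⊗ₜ y) = F.d x ⊗ₜ y + F.sign x ⊗ₜ G.d y := rfl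

lemma tensorDiff_tensorDiff (Z : (I →₀ MvPolynomial σ K) ⊗[K] (L →₀ MvPolynomial τ K)) :
    F.tensorDiff G (F.tensorDiff G Z) = 0 := by
  induction Z using TensorProduct.induction_on with
  | zero => rw [map_zero, map_zero]
  | add a b ha hb => rw [map_add, map_add, ha, hb, add_zero]
  | tmul x y =>
    rw [tensorDiff_tmul, map_add, tensorDiff_tmul, tensorDiff_tmul, F.d_d, G.d_d, d_sign,
      zero_tmul, tmul_zero, zero_add, add_zero, neg_tmul]
    abel

/-- The tensor product complex is exact in positive homological degrees: the `K`-linear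
contractions of the two factors are applied one after the other. -/
lemma exists_of_tensorDiff_eq_zero
    (Z : (I →₀ MvPolynomial σ K) ⊗[K] (L →₀ MvPolynomial τ K)) (hZ : F.tensorDiff G Z = 0)
    (e : σ ⊕ τ ≃ υ) :
    ∃ W c, freeTensorEquiv K e I L Z =
      freeTensorEquiv K e I L (F.tensorDiff G W) + Finsupp.single (F.o, G.o) c := by
  obtain ⟨s, p, hp, hpo⟩ := F.exists_contraction
  obtain ⟨t, q, hq, hqo⟩ := G.exists_contraction
  have hdq : ∀ y, G.d (q y) = 0 := by
    intro y
    obtain ⟨r, hr⟩ := hqo y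
    rw [hr, d_o]
  -- `1 ⊗ t` is a homotopy from the identity to `1 ⊗ q`; the Koszul sign is in `F.sign`.
  have h1 : ∀ Z, F.tensorDiff G (TensorProduct.map (F.sign.restrictScalars K) t Z) +
      TensorProduct.map (F.sign.restrictScalars K) t (F.tensorDiff G Z) =
      Z - TensorProduct.map LinearMap.id q Z := by
    intro Z
    induction Z using TensorProduct.induction_on with
    | zero => simp
    | add a b ha hb =>
      simp only [map_add]
      refine Eq.trans (b := (a - TensorProduct.map LinearMap.id q a) +
        (b - TensorProduct.map LinearMap.id q b)) ?_ (by abel)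
      rw [← ha, ← hb]
      abel
    | tmul x y =>
      rw [map_tmul, map_tmul, tensorDiff_tmul, tensorDiff_tmul, map_add, map_tmul, map_tmul]
      simp only [LinearMap.coe_restrictScalars, LinearMap.id_apply]
      rw [d_sign, sign_sign, neg_tmul, hq, tmul_sub, tmul_sub]
      abel
  have h2 : ∀ Z, F.tensorDiff G (TensorProduct.map LinearMap.id q Z) =
      TensorProduct.map (F.d.restrictScalars K) q Z := by
    intro Z
    induction Z using TensorProduct.induction_on with
    | zero => simp
    | add a b ha hb => simp only [map_add, ha, hb]
    | tmul x y =>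
      rw [map_tmul, map_tmul, tensorDiff_tmul, hdq, tmul_zero, add_zero]
      rfl
  -- `s ⊗ q` is a homotopy from `1 ⊗ q` to `p ⊗ q`.
  have h3 : ∀ Z, TensorProduct.map LinearMap.id q Z = F.tensorDiff G (TensorProduct.map s q Z) +
      TensorProduct.map s LinearMap.id (TensorProduct.map (F.d.restrictScalars K) q Z) +
      TensorProduct.map p q Z := by
    intro Z
    induction Z using TensorProduct.induction_on with
    | zero => simp
    | add a b ha hb =>
      simp only [map_add]
      rw [ha, hb]
      abel
    | tmul x y =>
      simp only [map_tmul, tensorDiff_tmul, hdq, tmul_zero, add_zero, LinearMap.id_apply,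
        LinearMap.coe_restrictScalars]
      rw [← add_tmul, ← add_tmul, hp]
      congr 1
      abel
  have h4 : ∀ Z, ∃ c, freeTensorEquiv K e I L (TensorProduct.map p q Z) =
      Finsupp.single (F.o, G.o) c := by
    intro Z
    induction Z using TensorProduct.induction_on with
    | zero => exact ⟨0, by simp⟩
    | add a b ha hb =>
      obtain ⟨c, hc⟩ := ha
      obtain ⟨c', hc'⟩ := hb
      exact ⟨c + c', by rw [map_add, map_add, hc, hc', Finsupp.single_add]⟩
    | tmul x y =>
      obtain ⟨r, hr⟩ := hpo x
      obtain ⟨r', hr'⟩ := hqo y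
      exact ⟨_, by rw [map_tmul, hr, hr', freeTensorEquiv_single]⟩
  have e1 := h1 Z
  rw [hZ, map_zero, add_zero] at e1
  have e2 : TensorProduct.map (F.d.restrictScalars K) q Z = 0 := by
    rw [← h2, ← sub_sub_cancel Z (TensorProduct.map LinearMap.id q Z), ← e1, map_sub, hZ,
      tensorDiff_tensorDiff]
    abel
  have e3 := h3 Z
  rw [e2, map_zero, add_zero] at e3
  obtain ⟨c, hc⟩ := h4 Z
  refine ⟨TensorProduct.map (F.sign.restrictScalars K) t Z + TensorProduct.map s q Z, c, ?_⟩
  rw [← hc, ← map_add, map_add (F.tensorDiff G), e1, add_assoc, ← e3, sub_add_cancel]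

variable (e : σ ⊕ τ ≃ υ)

/-- The differential of the tensor product complex on the free module over the polynomial ring in
all the variables. -/
noncomputable def tensorD :
    (I × L →₀ MvPolynomial υ K) →ₗ[MvPolynomial υ K] (I × L →₀ MvPolynomial υ K) :=
  Finsupp.linearCombination _ fun p : I × L => freeTensorEquiv K e I L
    (F.tensorDiff G (Finsupp.single p.1 1 ⊗ₜ Finsupp.single p.2 1))

lemma tensorD_freeTensorEquiv (Z : (I →₀ MvPolynomial σ K) ⊗[K] (L →₀ MvPolynomial τ K)) :
    F.tensorD G e (freeTensorEquiv K e I L Z) = freeTensorEquiv K e I L (F.tensorDiff G Z) := by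
  induction Z using TensorProduct.induction_on with
  | zero => simp
  | add a b ha hb => simp only [map_add, ha, hb]
  | tmul x y =>
    induction x using Finsupp.induction_linear with
    | zero => simp
    | add f g hf hg => simp only [add_tmul, map_add, hf, hg]
    | single a r =>
    induction y using Finsupp.induction_linear with
    | zero => simp
    | add f g hf hg => simp only [tmul_add, map_add, hf, hg]
    | single b q =>
      have h1 : F.sign (Finsupp.single a r) = r • F.sign (Finsupp.single a 1) := by
        rw [← map_smul, Finsupp.smul_single, smul_eq_mul, mul_one]
      have h2 : Finsupp.single b q = q • Finsupp.single b (1 : MvPolynomial τ K) := by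
        rw [Finsupp.smul_single, smul_eq_mul, mul_one]
      rw [freeTensorEquiv_single, tensorD, Finsupp.linearCombination_single, tensorDiff_tmul,
        tensorDiff_tmul, F.d_single a r, G.d_single b q, h1, h2, map_add, map_add, smul_add,
        freeTensorEquiv_smul, freeTensorEquiv_smul]

lemma tensorD_single_apply [DecidableEq I] [DecidableEq L] (p p' : I × L) :
    F.tensorD G e (Finsupp.single p 1) p' =
      (if p.2 = p'.2 then rename (e ∘ Sum.inl) (F.d (Finsupp.single p.1 1) p'.1) else 0) +
      (if p.1 = p'.1 then (-1) ^ F.hdeg p.1 *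
        rename (e ∘ Sum.inr) (G.d (Finsupp.single p.2 1) p'.2) else 0) := by
  rw [tensorD, Finsupp.linearCombination_single, one_smul, tensorDiff_tmul, map_add,
    Finsupp.add_apply, freeTensorEquiv_tmul_apply, freeTensorEquiv_tmul_apply, sign_single,
    Finsupp.single_apply, Finsupp.single_apply]
  congr 1
  · split_ifs <;> simp
  · split_ifs <;> simp

lemma tensorD_apply_o_mem (W : I × L →₀ MvPolynomial υ K) : F.tensorD G e W (F.o, G.o) ∈
    J₁.map (rename (R := K) (e ∘ Sum.inl)) ⊔ J₂.map (rename (R := K) (e ∘ Sum.inr)) := by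
  classical
  induction W using Finsupp.induction_linear with
  | zero => simp
  | add f g hf hg => rw [map_add, Finsupp.add_apply]; exact add_mem hf hg
  | single p r =>
    have : Finsupp.single p r = r • Finsupp.single p (1 : MvPolynomial υ K) := by
      rw [Finsupp.smul_single, smul_eq_mul, mul_one]
    rw [this, map_smul, Finsupp.smul_apply, smul_eq_mul, tensorD_single_apply]
    refine Ideal.mul_mem_left _ _ (add_mem ?_ ?_)
    · split_ifs
      · exact Ideal.mem_sup_left (Ideal.mem_map_of_mem _ (F.d_apply_o_mem _))
      · exact zero_mem _
    · split_ifs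
      · exact Ideal.mem_sup_right (Ideal.mul_mem_left _ _
          (Ideal.mem_map_of_mem _ (G.d_apply_o_mem _)))
      · exact zero_mem _

/-- The tensor product over the field of minimal resolutions of `S₁ / J₁` and `S₂ / J₂` is a
minimal resolution of `S₁ / J₁ ⊗ S₂ / J₂`. -/
noncomputable def tensor : CyclicResolution
    (J₁.map (rename (R := K) (e ∘ Sum.inl)) ⊔ J₂.map (rename (R := K) (e ∘ Sum.inr)))
    (I × L) where
  hdeg p := F.hdeg p.1 + G.hdeg p.2
  deg p := F.deg p.1 + G.deg p.2
  d := F.tensorD G e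
  o := (F.o, G.o)
  deg_o := by simp only [F.deg_o, G.deg_o]
  hdeg_eq_zero := by
    rintro ⟨a, b⟩
    rw [Nat.add_eq_zero_iff, F.hdeg_eq_zero, G.hdeg_eq_zero, Prod.mk.injEq]
  hdeg_d := by
    classical
    rintro ⟨a, b⟩ ⟨a', b'⟩ h
    rw [tensorD_single_apply] at h
    by_cases hF : b = b' ∧ F.d (Finsupp.single a 1) a' ≠ 0
    · have := F.hdeg_d a a' hF.2
      simp only [← hF.1]
      omega
    · by_cases hG : a = a' ∧ G.d (Finsupp.single b 1) b' ≠ 0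
      · have := G.hdeg_d b b' hG.2
        simp only [← hG.1]
        omega
      · refine absurd ?_ h
        rw [ite_eq_right_iff.2 fun h1 => by
            rw [not_not.1 fun h2 => hF ⟨h1, h2⟩, map_zero],
          ite_eq_right_iff.2 fun h1 => by
            rw [not_not.1 fun h2 => hG ⟨h1, h2⟩, map_zero, mul_zero], add_zero]
  deg_d := by
    classical
    rintro ⟨a, b⟩ ⟨a', b'⟩
    rw [tensorD_single_apply]
    refine add_mem ?_ ?_
    · split_ifs with h
      · simp only at h
        rw [h]
        exact shiftedHomogeneous_add_left (rename_mem_shiftedHomogeneous _ (F.deg_d a a'))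
      · exact zero_mem _
    · split_ifs with h
      · simp only at h
        rw [h]
        have := shiftedHomogeneous_add_left (k := F.deg a')
          (rename_mem_shiftedHomogeneous (e ∘ Sum.inr) (G.deg_d b b'))
        rw [add_comm, add_comm (G.deg b)] at this
        rcases neg_one_pow_eq_or (MvPolynomial υ K) (F.hdeg a') with h | h
        · simpa [h] using this
        · simpa [h] using this
      · exact zero_mem _
  minimal := by
    classical
    rintro ⟨a, b⟩ ⟨a', b'⟩
    rw [tensorD_single_apply, map_add, apply_ite constantCoeff, apply_ite constantCoeff, map_mul,
      constantCoeff_rename, constantCoeff_rename, F.minimal, G.minimal, mul_zero, map_zero]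
    simp
  d_d := by
    intro z
    obtain ⟨Z, rfl⟩ := (freeTensorEquiv K e I L).surjective z
    rw [tensorD_freeTensorEquiv, tensorD_freeTensorEquiv, tensorDiff_tensorDiff, map_zero]
  exact := by
    intro z hz
    obtain ⟨Z, rfl⟩ := (freeTensorEquiv K e I L).surjective z
    rw [tensorD_freeTensorEquiv, EmbeddingLike.map_eq_zero_iff] at hz
    obtain ⟨W, c, h⟩ := F.exists_of_tensorDiff_eq_zero G Z hz e
    exact ⟨freeTensorEquiv K e I L W, c, by rw [h, tensorD_freeTensorEquiv]⟩
  mem_iff := by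
    intro r
    constructor
    · rintro ⟨W, hW⟩
      have := F.tensorD_apply_o_mem G e W
      rwa [hW, Finsupp.single_eq_same] at this
    · intro hr
      have key : J₁.map (rename (R := K) (e ∘ Sum.inl)) ⊔ J₂.map (rename (R := K) (e ∘ Sum.inr)) ≤
          (LinearMap.range (F.tensorD G e)).comap (Finsupp.lsingle (F.o, G.o)) := by
        refine sup_le (Ideal.map_le_iff_le_comap.2 fun r hr => ?_)
          (Ideal.map_le_iff_le_comap.2 fun r hr => ?_)
        · obtain ⟨w, hw⟩ := F.single_mem_of_mem hr
          refine ⟨freeTensorEquiv K e I L (w ⊗ₜ Finsupp.single G.o 1), ?_⟩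
          rw [tensorD_freeTensorEquiv, tensorDiff_tmul, hw, d_o, tmul_zero, add_zero,
            freeTensorEquiv_single, map_one, mul_one]
          rfl
        · obtain ⟨w, hw⟩ := G.single_mem_of_mem hr
          refine ⟨freeTensorEquiv K e I L (Finsupp.single F.o 1 ⊗ₜ w), ?_⟩
          rw [tensorD_freeTensorEquiv, tensorDiff_tmul, hw, d_o, zero_tmul, zero_add, sign_single,
            hdeg_o, freeTensorEquiv_single, pow_zero, mul_one, map_one, one_mul]
          rfl
      exact key hr
  finite := by
    intro n
    refine ((Set.finite_le_nat n).biUnion fun i _ => (F.finite i).prod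
      ((Set.finite_le_nat n).biUnion fun j _ => G.finite j)).subset ?_
    rintro ⟨a, b⟩ h
    simp only [Set.mem_ofPred_eq] at h
    simp only [Set.mem_iUnion, Set.mem_prod, Set.mem_ofPred_eq]
    exact ⟨F.hdeg a, by omega, rfl, G.hdeg b, by omega, rfl⟩

end CyclicResolution

/-- The regularity is additive over ideals in disjoint sets of variables. -/
theorem HasRegularity.tensor {J₁ : Ideal (MvPolynomial σ K)} {J₂ : Ideal (MvPolynomial τ K)}
    {r₁ r₂ : EReal} (h₁ : HasRegularity J₁ r₁) (h₂ : HasRegularity J₂ r₂) (e : σ ⊕ τ ≃ υ) :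
    HasRegularity (J₁.map (rename (R := K) (e ∘ Sum.inl)) ⊔
      J₂.map (rename (R := K) (e ∘ Sum.inr))) (r₁ + r₂) := by
  obtain ⟨I, F, rfl⟩ := h₁
  obtain ⟨L, G, rfl⟩ := h₂
  refine ⟨I × L, F.tensor G e, ?_⟩
  rw [← ereal_iSup_prod_add]
  congr 1
  ext1 p
  rw [← EReal.coe_add]
  simp only [CyclicResolution.tensor]
  congr 1
  push_cast
  ring

end BinomialEdge

/-! ### Existence of minimal resolutions -/

namespace BinomialEdge

open MvPolynomial

variable {K : Type*} [Field K] {σ : Type*}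

variable (K σ) in
/-- The projection onto the homogeneous elements of degree `n` of `S(-m)`. -/
noncomputable def shiftedComponent (m n : ℕ) : MvPolynomial σ K →ₗ[K] MvPolynomial σ K :=
  if m ≤ n then homogeneousComponent (n - m) else 0

lemma coeff_shiftedComponent (m n : ℕ) (p : MvPolynomial σ K) (s : σ →₀ ℕ) :
    coeff s (shiftedComponent K σ m n p) = if m + s.degree = n then coeff s p else 0 := by
  classical
  rw [shiftedComponent]
  split_ifs with h1 h2 h2
  · rw [coeff_homogeneousComponent, if_pos (by omega)]
  · rw [coeff_homogeneousComponent, if_neg (by omega)]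
  · omega
  · rfl

lemma shiftedComponent_mem (m n : ℕ) (p : MvPolynomial σ K) :
    shiftedComponent K σ m n p ∈ shiftedHomogeneous K σ m n := by
  intro s hs
  rw [coeff_shiftedComponent] at hs
  by_contra h
  exact hs (if_neg h)

lemma shiftedComponent_of_mem {m n k : ℕ} {p : MvPolynomial σ K}
    (hp : p ∈ shiftedHomogeneous K σ m n) :
    shiftedComponent K σ m k p = if n = k then p else 0 := by
  ext s
  rw [coeff_shiftedComponent]
  by_cases h0 : coeff s p = 0
  · rw [h0, ite_self]; split_ifs <;> simp [h0]
  · rw [hp s h0]; split_ifs <;> simp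

lemma shiftedComponent_mul {l m n : ℕ} (c : MvPolynomial σ K) {g : MvPolynomial σ K}
    (hg : g ∈ shiftedHomogeneous K σ l m) :
    shiftedComponent K σ l n (c * g) = shiftedComponent K σ m n c * g := by
  induction c using MvPolynomial.induction_on' with
  | monomial s r =>
    have h1 : monomial s r ∈ shiftedHomogeneous K σ m (m + s.degree) :=
      mem_shiftedHomogeneous_add.2 (isHomogeneous_monomial r rfl)
    have h2 : monomial s r * g ∈ shiftedHomogeneous K σ l (m + s.degree) := by
      rw [mul_comm]; exact mul_mem_shiftedHomogeneous hg h1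
    rw [shiftedComponent_of_mem h1, shiftedComponent_of_mem h2, ite_mul, zero_mul]
  | add p q hp hq => rw [add_mul, map_add, map_add, hp, hq, add_mul]

lemma sum_shiftedComponent {m N : ℕ} (p : MvPolynomial σ K) (hN : m + p.totalDegree < N) :
    ∑ n ∈ Finset.range N, shiftedComponent K σ m n p = p := by
  ext s
  rw [coeff_sum]
  simp only [coeff_shiftedComponent]
  rw [Finset.sum_ite_eq]
  split_ifs with h
  · rfl
  · by_contra h0
    refine h (Finset.mem_range.2 (lt_of_le_of_lt ?_ hN))
    have h1 : s.degree ≤ p.totalDegree := le_totalDegree (mem_support_iff.2 (Ne.symm h0))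
    omega

/-- A submodule of a graded free module is graded if it contains the homogeneous components of its
elements; `deg` holds the degrees of the basis elements. -/
def IsGradedSubmodule {ι : Type*} (deg : ι → ℕ) (Z : Submodule (MvPolynomial σ K)
    (ι → MvPolynomial σ K)) : Prop :=
  ∀ z ∈ Z, ∀ n, (fun b => shiftedComponent K σ (deg b) n (z b)) ∈ Z

lemma exists_homogeneous_generators [Finite σ] {ι : Type*} [Fintype ι] {deg : ι → ℕ}
    {Z : Submodule (MvPolynomial σ K) (ι → MvPolynomial σ K)} (hZ : IsGradedSubmodule deg Z) :
    ∃ (n : ℕ) (deg' : Fin n → ℕ) (g : Fin n → ι → MvPolynomial σ K),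
      (∀ a b, g a b ∈ shiftedHomogeneous K σ (deg b) (deg' a)) ∧
      Submodule.span (MvPolynomial σ K) (Set.range g) = Z := by
  set H : Set (ι → MvPolynomial σ K) :=
    {z | z ∈ Z ∧ ∃ k, ∀ b, z b ∈ shiftedHomogeneous K σ (deg b) k} with hH
  have hspan : Submodule.span (MvPolynomial σ K) H = Z := by
    refine le_antisymm (Submodule.span_le.2 fun z hz => hz.1) fun z hz => ?_
    obtain ⟨N, hN⟩ : ∃ N, ∀ b, deg b + (z b).totalDegree < N :=
      ⟨(∑ b, (deg b + (z b).totalDegree)) + 1, fun b => Nat.lt_succ_of_le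
        (Finset.single_le_sum (f := fun b => deg b + (z b).totalDegree)
          (fun _ _ => Nat.zero_le _) (Finset.mem_univ b))⟩
    have : z = ∑ n ∈ Finset.range N, fun b => shiftedComponent K σ (deg b) n (z b) := by
      ext1 b
      rw [Finset.sum_apply, sum_shiftedComponent _ (hN b)]
    rw [this]
    exact Submodule.sum_mem _ fun n _ => Submodule.subset_span
      ⟨hZ z hz n, n, fun b => shiftedComponent_mem _ _ _⟩
  obtain ⟨T, hTH, hT⟩ := (Submodule.fg_span_iff_fg_span_finset_subset
    (R := MvPolynomial σ K) H).1 (IsNoetherian.noetherian _)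
  have hdeg : ∀ a : Fin T.card, ∃ k, ∀ b, (T.equivFin.symm a : ι → MvPolynomial σ K) b ∈
      shiftedHomogeneous K σ (deg b) k := fun a => (hTH (T.equivFin.symm a).2).2
  choose deg' hdeg' using hdeg
  refine ⟨T.card, deg', fun a => T.equivFin.symm a, hdeg', ?_⟩
  rw [← hspan, hT]
  congr 1
  ext z
  constructor
  · rintro ⟨a, rfl⟩; exact (T.equivFin.symm a).2
  · intro hz; exact ⟨T.equivFin ⟨z, hz⟩, by simp⟩

/-- A graded submodule of a graded free module has homogeneous generators all of whose syzygies have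
their entries in the maximal ideal: a shortest list of homogeneous generators will do. -/
lemma exists_minimal_generators [Finite σ] {ι : Type*} [Fintype ι] {deg : ι → ℕ}
    {Z : Submodule (MvPolynomial σ K) (ι → MvPolynomial σ K)} (hZ : IsGradedSubmodule deg Z) :
    ∃ (n : ℕ) (deg' : Fin n → ℕ) (g : Fin n → ι → MvPolynomial σ K),
      (∀ a b, g a b ∈ shiftedHomogeneous K σ (deg b) (deg' a)) ∧
      Submodule.span (MvPolynomial σ K) (Set.range g) = Z ∧
      ∀ c : Fin n → MvPolynomial σ K, ∑ a, c a • g a = 0 → ∀ a, constantCoeff (c a) = 0 := by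
  classical
  have hex := exists_homogeneous_generators hZ
  obtain ⟨deg', g, hg, hspan⟩ := Nat.find_spec hex
  refine ⟨Nat.find hex, deg', g, hg, hspan, fun c hc a₀ => ?_⟩
  by_contra hc0
  obtain ⟨m, hm⟩ : ∃ m, Nat.find hex = m + 1 := ⟨Nat.find hex - 1, by have := a₀.2; omega⟩
  refine Nat.find_min hex (m := m) (by omega) ?_
  generalize Nat.find hex = n at *
  subst hm
  refine ⟨fun a => deg' (a₀.succAbove a), fun a => g (a₀.succAbove a), fun a => hg _, ?_⟩
  -- In the component of the relation of degree `deg' a₀` the coefficient of `g a₀` is a unit.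
  have hc' : ∑ a, shiftedComponent K σ (deg' a) (deg' a₀) (c a) • g a = 0 := by
    ext1 b
    have := congrArg (fun z => shiftedComponent K σ (deg b) (deg' a₀) z) (congrFun hc b)
    simp only [Finset.sum_apply, Pi.smul_apply, smul_eq_mul, Pi.zero_apply, map_zero, map_sum]
      at this ⊢
    rw [← this]
    exact Finset.sum_congr rfl fun a _ => (shiftedComponent_mul _ (hg a b)).symm
  have hunit : shiftedComponent K σ (deg' a₀) (deg' a₀) (c a₀) = C (constantCoeff (c a₀)) := by
    rw [shiftedComponent, if_pos le_rfl, Nat.sub_self, homogeneousComponent_zero, constantCoeff_eq]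
  rw [Fin.sum_univ_succAbove _ a₀, hunit] at hc'
  refine le_antisymm ?_ ?_
  · rw [← hspan]
    refine Submodule.span_mono ?_
    rintro _ ⟨a, rfl⟩
    exact ⟨_, rfl⟩
  · rw [← hspan, Submodule.span_le]
    rintro _ ⟨a, rfl⟩
    rcases Fin.eq_self_or_eq_succAbove a₀ a with rfl | ⟨a', rfl⟩
    · have h1 := eq_neg_of_add_eq_zero_left hc'
      have h2 : g a = (C (constantCoeff (c a))⁻¹ : MvPolynomial σ K) •
          (C (constantCoeff (c a)) : MvPolynomial σ K) • g a := by
        rw [smul_smul, ← C_mul, inv_mul_cancel₀ hc0, C_1, one_smul]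
      rw [SetLike.mem_coe, h2, h1]
      refine Submodule.smul_mem _ _ (neg_mem (Submodule.sum_mem _ fun a' _ =>
        Submodule.smul_mem _ _ (Submodule.subset_span ⟨a', rfl⟩)))
    · exact Submodule.subset_span ⟨a', rfl⟩

variable (K σ) in
/-- A graded submodule of a graded free module of finite rank, to be covered by the next step of a
resolution. -/
structure SyzygyModule where
  /-- the rank of the free module -/
  rank : ℕ
  /-- the degrees of the basis elements -/
  deg : Fin rank → ℕ
  /-- the submodule -/
  carrier : Submodule (MvPolynomial σ K) (Fin rank → MvPolynomial σ K)
  isGraded : IsGradedSubmodule deg carrier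

namespace SyzygyModule

variable [Finite σ] (Z : SyzygyModule K σ)

/-- The number of generators in a minimal system. -/
noncomputable def genRank : ℕ := (exists_minimal_generators Z.isGraded).choose

/-- The degrees of the generators in a minimal system. -/
noncomputable def genDeg : Fin Z.genRank → ℕ :=
  (exists_minimal_generators Z.isGraded).choose_spec.choose

/-- A minimal system of homogeneous generators. -/
noncomputable def gen : Fin Z.genRank → Fin Z.rank → MvPolynomial σ K :=
  (exists_minimal_generators Z.isGraded).choose_spec.choose_spec.choose

lemma gen_mem (a : Fin Z.genRank) (b : Fin Z.rank) :
    Z.gen a b ∈ shiftedHomogeneous K σ (Z.deg b) (Z.genDeg a) :=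
  (exists_minimal_generators Z.isGraded).choose_spec.choose_spec.choose_spec.1 a b

lemma span_gen : Submodule.span (MvPolynomial σ K) (Set.range Z.gen) = Z.carrier :=
  (exists_minimal_generators Z.isGraded).choose_spec.choose_spec.choose_spec.2.1

/-- The minimal cover of `Z` by a free module. -/
noncomputable def cover :
    (Fin Z.genRank → MvPolynomial σ K) →ₗ[MvPolynomial σ K] (Fin Z.rank → MvPolynomial σ K) :=
  Fintype.linearCombination (MvPolynomial σ K) Z.gen

lemma range_cover : LinearMap.range Z.cover = Z.carrier := by
  rw [cover, Fintype.range_linearCombination, span_gen]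

lemma cover_single (a : Fin Z.genRank) : Z.cover (Pi.single a 1) = Z.gen a := by
  classical
  rw [cover, Fintype.linearCombination_apply_single, one_smul]

/-- The syzygies of a minimal system of generators of `Z`. -/
noncomputable def next : SyzygyModule K σ where
  rank := Z.genRank
  deg := Z.genDeg
  carrier := LinearMap.ker Z.cover
  isGraded := by
    intro z hz n
    rw [LinearMap.mem_ker, cover, Fintype.linearCombination_apply] at hz ⊢
    ext1 b
    have := congrArg (fun z => shiftedComponent K σ (Z.deg b) n z) (congrFun hz b)
    simp only [Finset.sum_apply, Pi.smul_apply, smul_eq_mul, Pi.zero_apply, map_zero, map_sum]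
      at this ⊢
    rw [← this]
    exact Finset.sum_congr rfl fun a _ => (shiftedComponent_mul _ (Z.gen_mem a b)).symm

lemma constantCoeff_of_mem_next {c : Fin Z.genRank → MvPolynomial σ K}
    (hc : c ∈ Z.next.carrier) (a : Fin Z.genRank) : constantCoeff (c a) = 0 :=
  (exists_minimal_generators Z.isGraded).choose_spec.choose_spec.choose_spec.2.2 c
    (by
      have h : Z.cover c = 0 := hc
      rwa [cover, Fintype.linearCombination_apply] at h) a

end SyzygyModule

/-- A homogeneous ideal as a graded submodule of the free module of rank one. -/
noncomputable def idealSyzygyModule (J : Ideal (MvPolynomial σ K))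
    (hJ : ∀ p ∈ J, ∀ n, homogeneousComponent n p ∈ J) : SyzygyModule K σ where
  rank := 1
  deg := 0
  carrier := Submodule.comap (LinearMap.proj 0) J
  isGraded := by
    intro z hz n
    have : shiftedComponent K σ 0 n (z 0) ∈ J := by
      rw [shiftedComponent, if_pos (Nat.zero_le n)]; exact hJ _ hz _
    exact this

section Construction

variable [Finite σ] (J : Ideal (MvPolynomial σ K))
  (hJ : ∀ p ∈ J, ∀ n, homogeneousComponent n p ∈ J)

/-- The sequence of iterated syzygy modules of a homogeneous ideal. -/
noncomputable def syzygySeq : ℕ → SyzygyModule K σ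
  | 0 => idealSyzygyModule J hJ
  | i + 1 => (syzygySeq i).next

/-- The generator of the rank one free module containing the ideal. -/
noncomputable def syzygyBase : Fin (syzygySeq J hJ 0).rank := (0 : Fin 1)

lemma eq_syzygyBase (a : Fin (syzygySeq J hJ 0).rank) : a = syzygyBase J hJ :=
  Subsingleton.elim (α := Fin 1) a 0

/-- The map from the `(i + 1)`-st to the `i`-th free module. -/
noncomputable def syzygyMap (i : ℕ) : (Fin (syzygySeq J hJ (i + 1)).rank → MvPolynomial σ K)
    →ₗ[MvPolynomial σ K] (Fin (syzygySeq J hJ i).rank → MvPolynomial σ K) :=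
  (syzygySeq J hJ i).cover

lemma syzygyMap_single_mem (i : ℕ) (a b) : syzygyMap J hJ i (Pi.single a 1) b ∈
    shiftedHomogeneous K σ ((syzygySeq J hJ i).deg b) ((syzygySeq J hJ (i + 1)).deg a) :=
  (congrFun ((syzygySeq J hJ i).cover_single a) b) ▸ (syzygySeq J hJ i).gen_mem a b

lemma range_syzygyMap_succ (i : ℕ) :
    LinearMap.range (syzygyMap J hJ (i + 1)) = LinearMap.ker (syzygyMap J hJ i) :=
  (syzygySeq J hJ (i + 1)).range_cover

lemma mem_range_syzygyMap_zero (x : Fin (syzygySeq J hJ 0).rank → MvPolynomial σ K) :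
    x ∈ LinearMap.range (syzygyMap J hJ 0) ↔ x (syzygyBase J hJ) ∈ J :=
  SetLike.ext_iff.1 (syzygySeq J hJ 0).range_cover x

lemma constantCoeff_of_syzygyMap_eq_zero (i : ℕ) {x : Fin (syzygySeq J hJ (i + 1)).rank → _}
    (hx : syzygyMap J hJ i x = 0) (a) : constantCoeff (x a) = 0 :=
  (syzygySeq J hJ i).constantCoeff_of_mem_next hx a

/-- The `i`-th free module of the resolution, in the sum of all of them. -/
noncomputable def embedDegree (i : ℕ) : (Fin (syzygySeq J hJ i).rank → MvPolynomial σ K)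
    →ₗ[MvPolynomial σ K] ((Σ i, Fin (syzygySeq J hJ i).rank) →₀ MvPolynomial σ K) :=
  Fintype.linearCombination (MvPolynomial σ K) fun a => Finsupp.single ⟨i, a⟩ 1

/-- The component of an element in the `i`-th free module. -/
noncomputable def projectDegree (i : ℕ) :
    ((Σ i, Fin (syzygySeq J hJ i).rank) →₀ MvPolynomial σ K)
    →ₗ[MvPolynomial σ K] (Fin (syzygySeq J hJ i).rank → MvPolynomial σ K) :=
  LinearMap.pi fun a => Finsupp.lapply ⟨i, a⟩

lemma projectDegree_apply (i : ℕ) (z : (Σ i, Fin (syzygySeq J hJ i).rank) →₀ MvPolynomial σ K)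
    (a) : projectDegree J hJ i z a = z ⟨i, a⟩ := rfl

lemma embedDegree_apply_self (i : ℕ) (x) (a) : embedDegree J hJ i x ⟨i, a⟩ = x a := by
  classical
  simp [embedDegree, Fintype.linearCombination_apply, Finsupp.single_apply]

lemma embedDegree_apply_of_ne {i j : ℕ} (hij : i ≠ j) (x) (a) :
    embedDegree J hJ i x ⟨j, a⟩ = 0 := by
  classical
  simp [embedDegree, Fintype.linearCombination_apply, hij]

lemma embedDegree_single (i : ℕ) (a) :
    embedDegree J hJ i (Pi.single a 1) = Finsupp.single ⟨i, a⟩ 1 := by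
  classical
  rw [embedDegree, Fintype.linearCombination_apply_single, one_smul]

lemma projectDegree_embedDegree (i : ℕ) (x) :
    projectDegree J hJ i (embedDegree J hJ i x) = x := by
  ext1 a
  rw [projectDegree_apply, embedDegree_apply_self]

lemma exists_sum_embedDegree (z : (Σ i, Fin (syzygySeq J hJ i).rank) →₀ MvPolynomial σ K) :
    ∃ N, z = embedDegree J hJ 0 (projectDegree J hJ 0 z) +
      ∑ i ∈ Finset.range N, embedDegree J hJ (i + 1) (projectDegree J hJ (i + 1) z) := by
  classical
  obtain ⟨N, hN⟩ : ∃ N, ∀ p ∈ z.support, p.1 < N + 1 :=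
    ⟨z.support.sup Sigma.fst, fun p hp => Nat.lt_succ_of_le (Finset.le_sup (f := Sigma.fst) hp)⟩
  refine ⟨N, ?_⟩
  rw [add_comm, ← Finset.sum_range_succ' fun i => embedDegree J hJ i (projectDegree J hJ i z)]
  ext1 ⟨j, a⟩
  rw [Finsupp.finsetSum_apply]
  by_cases h : z ⟨j, a⟩ = 0
  · rw [h, Finset.sum_eq_zero]
    intro i _
    by_cases hij : i = j
    · subst hij; rw [embedDegree_apply_self, projectDegree_apply, h]
    · rw [embedDegree_apply_of_ne _ _ hij]
  · rw [Finset.sum_eq_single j, embedDegree_apply_self, projectDegree_apply]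
    · intro i _ hij
      rw [embedDegree_apply_of_ne _ _ hij]
    · intro hj
      exact absurd (Finset.mem_range.2 (hN _ (Finsupp.mem_support_iff.2 h))) hj

/-- The image of a basis element under the differential. -/
noncomputable def syzygyDiffBasis : (Σ i, Fin (syzygySeq J hJ i).rank) →
    ((Σ i, Fin (syzygySeq J hJ i).rank) →₀ MvPolynomial σ K)
  | ⟨0, _⟩ => 0
  | ⟨i + 1, a⟩ => embedDegree J hJ i (syzygyMap J hJ i (Pi.single a 1))

/-- The differential of the iterated syzygy resolution. -/
noncomputable def syzygyDiff :
    ((Σ i, Fin (syzygySeq J hJ i).rank) →₀ MvPolynomial σ K) →ₗ[MvPolynomial σ K]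
    ((Σ i, Fin (syzygySeq J hJ i).rank) →₀ MvPolynomial σ K) :=
  Finsupp.linearCombination _ (syzygyDiffBasis J hJ)

lemma syzygyDiff_single (p) :
    syzygyDiff J hJ (Finsupp.single p 1) = syzygyDiffBasis J hJ p := by
  rw [syzygyDiff, Finsupp.linearCombination_single, one_smul]

lemma syzygyDiff_embedDegree_zero (x) : syzygyDiff J hJ (embedDegree J hJ 0 x) = 0 := by
  simp [embedDegree, Fintype.linearCombination_apply, syzygyDiff, syzygyDiffBasis]

lemma syzygyDiff_embedDegree_succ (i : ℕ) (x) :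
    syzygyDiff J hJ (embedDegree J hJ (i + 1) x) =
      embedDegree J hJ i (syzygyMap J hJ i x) := by
  have key : syzygyDiff J hJ ∘ₗ embedDegree J hJ (i + 1) =
      embedDegree J hJ i ∘ₗ syzygyMap J hJ i := by
    refine LinearMap.pi_ext' fun a => LinearMap.ext_ring ?_
    change syzygyDiff J hJ (embedDegree J hJ (i + 1) (Pi.single a 1)) =
      embedDegree J hJ i (syzygyMap J hJ i (Pi.single a 1))
    rw [embedDegree_single, syzygyDiff_single]
    rfl
  exact LinearMap.congr_fun key x

lemma projectDegree_syzygyDiff (i : ℕ) (z) : projectDegree J hJ i (syzygyDiff J hJ z) =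
    syzygyMap J hJ i (projectDegree J hJ (i + 1) z) := by
  have key : projectDegree J hJ i ∘ₗ syzygyDiff J hJ =
      syzygyMap J hJ i ∘ₗ projectDegree J hJ (i + 1) := by
    refine Finsupp.lhom_ext' fun p => LinearMap.ext_ring ?_
    change projectDegree J hJ i (syzygyDiff J hJ (Finsupp.single p 1)) =
      syzygyMap J hJ i (projectDegree J hJ (i + 1) (Finsupp.single p 1))
    obtain ⟨j, a⟩ := p
    rw [← embedDegree_single]
    have h0 : ∀ j k (x), j ≠ k → projectDegree J hJ k (embedDegree J hJ j x) = 0 := by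
      intro j k x h
      ext1 b
      rw [projectDegree_apply, embedDegree_apply_of_ne _ _ h]; rfl
    rcases j with _ | j
    · rw [syzygyDiff_embedDegree_zero, map_zero, h0 _ _ _ (by omega), map_zero]
    · rw [syzygyDiff_embedDegree_succ]
      by_cases hij : j = i
      · subst hij
        rw [projectDegree_embedDegree, projectDegree_embedDegree]
      · rw [h0 _ _ _ hij, h0 _ _ _ (by omega), map_zero]
  exact LinearMap.congr_fun key z

/-- The minimal resolution of `S / J` by iterated syzygies. -/
noncomputable def syzygyResolution (hJ0 : ∀ p ∈ J, constantCoeff p = 0) :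
    CyclicResolution J (Σ i, Fin (syzygySeq J hJ i).rank) where
  hdeg p := p.1
  deg p := (syzygySeq J hJ p.1).deg p.2
  d := syzygyDiff J hJ
  o := ⟨0, syzygyBase J hJ⟩
  deg_o := rfl
  hdeg_eq_zero := by
    rintro ⟨i, a⟩
    constructor
    · rintro rfl
      rw [eq_syzygyBase J hJ a]
    · intro h
      exact congrArg Sigma.fst h
  hdeg_d := by
    rintro ⟨i, a⟩ ⟨j, b⟩ h
    rw [syzygyDiff_single] at h
    rcases i with _ | i
    · exact absurd rfl h
    · by_contra hij
      exact h (embedDegree_apply_of_ne _ _ (by rintro rfl; exact hij rfl) _ _)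
  deg_d := by
    rintro ⟨i, a⟩ ⟨j, b⟩
    rw [syzygyDiff_single]
    rcases i with _ | i
    · exact zero_mem _
    · by_cases hij : i = j
      · subst hij
        simp only [syzygyDiffBasis, embedDegree_apply_self]
        exact syzygyMap_single_mem J hJ i a b
      · simp only [syzygyDiffBasis, embedDegree_apply_of_ne J hJ hij]
        exact zero_mem _
  minimal := by
    rintro ⟨i, a⟩ ⟨j, b⟩
    rw [syzygyDiff_single]
    rcases i with _ | i
    · exact map_zero _
    · by_cases hij : i = j
      · subst hij
        simp only [syzygyDiffBasis, embedDegree_apply_self]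
        have h1 : syzygyMap J hJ i (Pi.single a 1) ∈ LinearMap.range (syzygyMap J hJ i) :=
          ⟨_, rfl⟩
        rcases i with _ | i
        · rw [eq_syzygyBase J hJ b]
          exact hJ0 _ ((mem_range_syzygyMap_zero J hJ _).1 h1)
        · rw [range_syzygyMap_succ] at h1
          exact constantCoeff_of_syzygyMap_eq_zero J hJ i (LinearMap.mem_ker.1 h1) b
      · simp only [syzygyDiffBasis, embedDegree_apply_of_ne J hJ hij, map_zero]
  d_d := by
    intro z
    ext1 ⟨i, a⟩
    rw [← projectDegree_apply, projectDegree_syzygyDiff, projectDegree_syzygyDiff]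
    have h1 : syzygyMap J hJ (i + 1) (projectDegree J hJ (i + 1 + 1) z) ∈
        LinearMap.ker (syzygyMap J hJ i) := by
      rw [← range_syzygyMap_succ]; exact ⟨_, rfl⟩
    exact congrFun (LinearMap.mem_ker.1 h1) a
  exact := by
    intro z hz
    have h1 : ∀ i, ∃ w, syzygyMap J hJ (i + 1) w = projectDegree J hJ (i + 1) z := by
      intro i
      rw [← LinearMap.mem_range, range_syzygyMap_succ, LinearMap.mem_ker,
        ← projectDegree_syzygyDiff, hz, map_zero]
    choose w hw using h1
    obtain ⟨N, hN⟩ := exists_sum_embedDegree J hJ z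
    refine ⟨∑ i ∈ Finset.range N, embedDegree J hJ (i + 1 + 1) (w i), z ⟨0, syzygyBase J hJ⟩, ?_⟩
    conv_lhs => rw [hN]
    rw [map_sum, add_comm]
    congr 1
    · refine Finset.sum_congr rfl fun i _ => ?_
      rw [syzygyDiff_embedDegree_succ, hw]
    · rw [embedDegree, Fintype.linearCombination_apply]
      rw [Fintype.sum_eq_single (syzygyBase J hJ) fun a ha => absurd (eq_syzygyBase J hJ a) ha]
      rw [Finsupp.smul_single, smul_eq_mul, mul_one]
      rfl
  mem_iff := by
    intro r
    constructor
    · rintro ⟨w, hw⟩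
      have h2 : projectDegree J hJ 0 (syzygyDiff J hJ w) ∈ LinearMap.range (syzygyMap J hJ 0) := by
        rw [projectDegree_syzygyDiff]; exact ⟨_, rfl⟩
      rwa [hw, mem_range_syzygyMap_zero, projectDegree_apply, Finsupp.single_eq_same] at h2
    · intro hr
      obtain ⟨w, hw⟩ := (mem_range_syzygyMap_zero J hJ fun _ => r).2 hr
      refine ⟨embedDegree J hJ 1 w, ?_⟩
      rw [syzygyDiff_embedDegree_succ, hw, embedDegree, Fintype.linearCombination_apply,
        Fintype.sum_eq_single (syzygyBase J hJ) fun a ha => absurd (eq_syzygyBase J hJ a) ha,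
        Finsupp.smul_single, smul_eq_mul, mul_one]
  finite := by
    intro n
    refine (Set.finite_range fun a : Fin (syzygySeq J hJ n).rank =>
      (⟨n, a⟩ : Σ i, Fin (syzygySeq J hJ i).rank)).subset ?_
    rintro ⟨i, a⟩ h
    simp only [Set.mem_ofPred_eq] at h
    subst h
    exact ⟨a, rfl⟩

end Construction

theorem exists_hasRegularity [Finite σ] (J : Ideal (MvPolynomial σ K))
    (hJ : ∀ p ∈ J, ∀ n, homogeneousComponent n p ∈ J) (hJ0 : ∀ p ∈ J, constantCoeff p = 0) :
    ∃ r, HasRegularity J r :=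
  ⟨_, _, syzygyResolution J hJ hJ0, rfl⟩

end BinomialEdge

/-! ### Uniqueness of the graded Betti numbers -/

namespace BinomialEdge

open MvPolynomial

universe u v

/-- The projections of a graded module onto its homogeneous components. -/
structure GradingProjection {K : Type*} [Field K] {M : Type*} [AddCommGroup M] [Module K M]
    (ℳ : ℕ → Submodule K M) where
  /-- the projection onto the component of degree `n` -/
  proj : ℕ → M →+ M
  proj_mem : ∀ n x, proj n x ∈ ℳ n
  proj_of_mem : ∀ {m n x}, x ∈ ℳ m → proj n x = if m = n then x else 0
  exists_sum : ∀ x, ∃ N, x = ∑ n ∈ Finset.range N, proj n x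

namespace GradingProjection

variable {K : Type*} [Field K] {M M' : Type*} [AddCommGroup M] [Module K M]
  [AddCommGroup M'] [Module K M'] {ℳ : ℕ → Submodule K M} {ℳ' : ℕ → Submodule K M'}
  (P : GradingProjection ℳ) (P' : GradingProjection ℳ')

include P P' in
lemma map_proj (f : M →+ M') (hf : ∀ n x, x ∈ ℳ n → f x ∈ ℳ' n) (n : ℕ) (x : M) :
    f (P.proj n x) = P'.proj n (f x) := by
  obtain ⟨N, hN⟩ := P.exists_sum x
  have h1 : P'.proj n (f x) = if n < N then f (P.proj n x) else 0 := by
    conv_lhs => rw [hN]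
    rw [map_sum, map_sum, Finset.sum_congr rfl fun k _ =>
      P'.proj_of_mem (n := n) (hf k _ (P.proj_mem k x)), Finset.sum_ite_eq']
    simp
  have h2 : P.proj n x = if n < N then P.proj n x else 0 := by
    conv_lhs => rw [hN]
    rw [map_sum, Finset.sum_congr rfl fun k _ =>
      P.proj_of_mem (n := n) (P.proj_mem k x), Finset.sum_ite_eq']
    simp
  rw [h1]
  split_ifs with h
  · rfl
  · rw [h2, if_neg h, map_zero]

include P P' in
/-- The inverse of a bijective graded homomorphism is graded. -/
lemma mem_of_map_mem (f : M →+ M') (hf : ∀ n x, x ∈ ℳ n → f x ∈ ℳ' n)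
    (hinj : Function.Injective f) {n : ℕ} {x : M} (hx : f x ∈ ℳ' n) : x ∈ ℳ n := by
  have : f (P.proj n x) = f x := by
    rw [P.map_proj P' f hf, P'.proj_of_mem hx, if_pos rfl]
  exact hinj this ▸ P.proj_mem n x

end GradingProjection

section FreeModule

variable {K : Type u} [Field K] {σ : Type v}

variable (K σ) in
/-- The homogeneous elements of degree `n` of the graded free module whose basis elements have the
degrees `deg`. -/
def freeDegree {r : ℕ} (deg : Fin r → ℕ) (n : ℕ) : Submodule K (Fin r → MvPolynomial σ K) where
  carrier := {x | ∀ b, x b ∈ shiftedHomogeneous K σ (deg b) n}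
  zero_mem' _ := zero_mem _
  add_mem' hx hy b := add_mem (hx b) (hy b)
  smul_mem' c _ hx b := Submodule.smul_mem _ c (hx b)

lemma single_mem_freeDegree {r : ℕ} (deg : Fin r → ℕ) (a : Fin r) :
    Pi.single a (1 : MvPolynomial σ K) ∈ freeDegree K σ deg (deg a) := by
  classical
  intro b
  rw [Pi.single_apply]
  split_ifs with h
  · subst h
    exact mem_shiftedHomogeneous_add (k := 0).2 (isHomogeneous_one _ _)
  · exact zero_mem _

variable (K σ) in
/-- The grading of a graded free module. -/
noncomputable def freeProjection {r : ℕ} (deg : Fin r → ℕ) :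
    GradingProjection (freeDegree K σ deg) where
  proj n :=
    { toFun := fun x b => shiftedComponent K σ (deg b) n (x b)
      map_zero' := by ext1 b; simp
      map_add' := by intro x y; ext1 b; simp }
  proj_mem n x b := shiftedComponent_mem _ _ _
  proj_of_mem := by
    intro m n x hx
    ext1 b
    change shiftedComponent K σ (deg b) n (x b) = _
    rw [shiftedComponent_of_mem (hx b)]
    split_ifs <;> rfl
  exists_sum := by
    intro x
    obtain ⟨N, hN⟩ : ∃ N, ∀ b, deg b + (x b).totalDegree < N :=
      ⟨(∑ b, (deg b + (x b).totalDegree)) + 1, fun b => Nat.lt_succ_of_le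
        (Finset.single_le_sum (f := fun b => deg b + (x b).totalDegree)
          (fun _ _ => Nat.zero_le _) (Finset.mem_univ b))⟩
    refine ⟨N, ?_⟩
    ext1 b
    rw [Finset.sum_apply]
    exact (sum_shiftedComponent _ (hN b)).symm

lemma eq_sum_smul_single {r : ℕ} (x : Fin r → MvPolynomial σ K) :
    x = ∑ b, x b • (Pi.single b 1 : Fin r → MvPolynomial σ K) := by
  classical
  ext1 c
  simp [Finset.sum_apply, Pi.single_apply]

/-- A graded module structure is compatible with the multiplication by homogeneous polynomials. -/
def IsGradedModule {M : Type*} [AddCommGroup M] [Module K M] [Module (MvPolynomial σ K) M]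
    (ℳ : ℕ → Submodule K M) : Prop :=
  ∀ {k l : ℕ} {p : MvPolynomial σ K} {x : M}, p.IsHomogeneous k → x ∈ ℳ l → p • x ∈ ℳ (l + k)

lemma map_mem_of_mem_freeDegree {M : Type*} [AddCommGroup M] [Module K M]
    [Module (MvPolynomial σ K) M] {ℳ : ℕ → Submodule K M} (hℳ : IsGradedModule (σ := σ) ℳ)
    {r : ℕ} {deg : Fin r → ℕ} (φ : (Fin r → MvPolynomial σ K) →ₗ[MvPolynomial σ K] M)
    (hφ : ∀ a, φ (Pi.single a 1) ∈ ℳ (deg a)) {n : ℕ} {x : Fin r → MvPolynomial σ K}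
    (hx : x ∈ freeDegree K σ deg n) : φ x ∈ ℳ n := by
  rw [eq_sum_smul_single x, map_sum]
  refine Submodule.sum_mem _ fun b _ => ?_
  rw [map_smul]
  rcases mem_shiftedHomogeneous_iff.1 (hx b) with h | ⟨k, rfl, hk⟩
  · rw [h, zero_smul]; exact zero_mem _
  · exact hℳ hk (hφ b)

lemma isGradedModule_freeDegree {r : ℕ} (deg : Fin r → ℕ) :
    IsGradedModule (σ := σ) (freeDegree K σ deg) := by
  intro k l p x hp hx b
  rw [Pi.smul_apply, smul_eq_mul, mul_comm]
  exact mul_mem_shiftedHomogeneous (hx b) (mem_shiftedHomogeneous_add.2 hp)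

/-- A graded endomorphism of a graded free module which is the identity modulo the maximal ideal is
surjective: it is unitriangular with respect to the degree. -/
lemma surjective_of_unitriangular {r : ℕ} {deg : Fin r → ℕ}
    (χ : (Fin r → MvPolynomial σ K) →ₗ[MvPolynomial σ K] (Fin r → MvPolynomial σ K))
    (hχ : ∀ a, χ (Pi.single a 1) ∈ freeDegree K σ deg (deg a))
    (hχ1 : ∀ a b, constantCoeff
      ((χ (Pi.single a 1) - Pi.single a 1 : Fin r → MvPolynomial σ K) b) = 0) :
    Function.Surjective χ := by
  have key : ∀ n a, deg a = n → Pi.single a 1 ∈ LinearMap.range χ := by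
    intro n
    induction n using Nat.strong_induction_on with
    | _ n ih =>
    intro a ha
    have h1 : χ (Pi.single a 1) - Pi.single a 1 ∈ LinearMap.range χ := by
      rw [eq_sum_smul_single (χ (Pi.single a 1) - Pi.single a 1)]
      refine Submodule.sum_mem _ fun b _ => ?_
      by_cases hb : deg b < n
      · exact Submodule.smul_mem _ _ (ih _ hb b rfl)
      · rw [eq_zero_of_mem_of_constantCoeff (sub_mem (hχ a) (single_mem_freeDegree deg a) b)
          (hχ1 a b) (by omega), zero_smul]
        exact zero_mem _
    have h2 := sub_mem (⟨_, rfl⟩ : χ (Pi.single a 1) ∈ LinearMap.range χ) h1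
    rwa [sub_sub_cancel] at h2
  rw [← LinearMap.range_eq_top, eq_top_iff]
  intro x _
  rw [eq_sum_smul_single x]
  exact Submodule.sum_mem _ fun b _ => Submodule.smul_mem _ _ (key _ b rfl)

/-- The matrices of constant coefficients of two graded maps which are inverse to each other modulo
the maximal ideal are inverse to each other in each degree. -/
lemma constantCoeff_matrix_mul {r r' : ℕ} {deg : Fin r → ℕ} {deg' : Fin r' → ℕ}
    (φ : (Fin r → MvPolynomial σ K) →ₗ[MvPolynomial σ K] (Fin r' → MvPolynomial σ K))
    (ψ : (Fin r' → MvPolynomial σ K) →ₗ[MvPolynomial σ K] (Fin r → MvPolynomial σ K))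
    (hφ : ∀ a, φ (Pi.single a 1) ∈ freeDegree K σ deg' (deg a))
    (hχ : ∀ a b, constantCoeff
      ((ψ (φ (Pi.single a 1)) - Pi.single a 1 : Fin r → MvPolynomial σ K) b) = 0) (j : ℕ) :
    (Matrix.of fun (a : {a // deg a = j}) (b : {b // deg' b = j}) =>
        constantCoeff (ψ (Pi.single b.1 1) a.1)) *
      (Matrix.of fun (b : {b // deg' b = j}) (a : {a // deg a = j}) =>
        constantCoeff (φ (Pi.single a.1 1) b.1)) = 1 := by
  classical
  ext a a'
  rw [Matrix.mul_apply]
  simp only [Matrix.of_apply]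
  have h1 : constantCoeff (ψ (φ (Pi.single a'.1 1)) a.1) =
      ∑ b, constantCoeff (φ (Pi.single a'.1 1) b) * constantCoeff (ψ (Pi.single b 1) a.1) := by
    conv_lhs => rw [eq_sum_smul_single (φ (Pi.single a'.1 1))]
    rw [map_sum, Finset.sum_apply, map_sum]
    refine Finset.sum_congr rfl fun b _ => ?_
    rw [map_smul, Pi.smul_apply, smul_eq_mul, map_mul]
  have h2 := hχ a'.1 a.1
  rw [Pi.sub_apply, map_sub, sub_eq_zero, h1] at h2
  have h3 : ∀ b, deg' b ≠ j → constantCoeff (φ (Pi.single a'.1 1) b) = 0 := by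
    intro b hb
    by_contra h
    have := hφ a'.1 b 0 h
    rw [a'.2] at this
    simp at this
    exact hb this
  rw [← Finset.sum_subtype (Finset.univ.filter fun b => deg' b = j) (by simp)
    fun b => constantCoeff (ψ (Pi.single b 1) a.1) * constantCoeff (φ (Pi.single a'.1 1) b),
    Finset.sum_filter_of_ne fun b _ hb => by
      by_contra h
      exact hb (by rw [h3 b h, mul_zero])]
  simp only [mul_comm (constantCoeff (ψ _ _))]
  rw [h2, Matrix.one_apply, Pi.single_apply]
  simp only [Subtype.ext_iff]
  split_ifs
  · exact map_one _
  · exact map_zero _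

end FreeModule

section Betti

variable {K : Type u} [Field K] {σ : Type v} {M M' : Type (max u v)} [AddCommGroup M] [Module K M]
  [Module (MvPolynomial σ K) M] [AddCommGroup M'] [Module K M'] [Module (MvPolynomial σ K) M']
  {ℳ : ℕ → Submodule K M} {ℳ' : ℕ → Submodule K M'}

lemma aug_mem_of_mem (R : MinimalGradedFreeResolution σ ℳ) (hℳ : IsGradedModule (σ := σ) ℳ) {n : ℕ}
    {x : Fin (R.rank 0) → MvPolynomial σ K} (hx : x ∈ freeDegree K σ (R.deg 0) n) :
    R.aug x ∈ ℳ n :=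
  map_mem_of_mem_freeDegree hℳ R.aug R.aug_mem hx

lemma d_mem_freeDegree (R : MinimalGradedFreeResolution σ ℳ) (i : ℕ) (a : Fin (R.rank (i + 1))) :
    R.d i (Pi.single a 1) ∈ freeDegree K σ (R.deg i) (R.deg (i + 1) a) := fun b =>
  mem_shiftedHomogeneous_iff.2 (R.d_homogeneous i a b)

lemma constantCoeff_d (R : MinimalGradedFreeResolution σ ℳ) (i : ℕ)
    (x : Fin (R.rank (i + 1)) → MvPolynomial σ K) (b : Fin (R.rank i)) :
    constantCoeff (R.d i x b) = 0 := by
  conv_lhs => rw [eq_sum_smul_single x]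
  rw [map_sum, Finset.sum_apply, map_sum]
  refine Finset.sum_eq_zero fun a _ => ?_
  rw [map_smul, Pi.smul_apply, smul_eq_mul, map_mul, R.minimal, mul_zero]

/-- A graded homomorphism lifts to the first steps of two resolutions. -/
lemma exists_lift (R : MinimalGradedFreeResolution σ ℳ) (R' : MinimalGradedFreeResolution σ ℳ')
    (P' : GradingProjection ℳ') (hℳ' : IsGradedModule (σ := σ) ℳ')
    (f : M →ₗ[MvPolynomial σ K] M') (hf : ∀ n x, x ∈ ℳ n → f x ∈ ℳ' n) :
    ∃ φ : (Fin (R.rank 0) → MvPolynomial σ K) →ₗ[MvPolynomial σ K]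
        (Fin (R'.rank 0) → MvPolynomial σ K),
      (∀ a, φ (Pi.single a 1) ∈ freeDegree K σ (R'.deg 0) (R.deg 0 a)) ∧
      ∀ x, R'.aug (φ x) = f (R.aug x) := by
  classical
  have h : ∀ a, ∃ y ∈ freeDegree K σ (R'.deg 0) (R.deg 0 a),
      R'.aug y = f (R.aug (Pi.single a 1)) := by
    intro a
    obtain ⟨y, hy⟩ := R'.aug_surjective (f (R.aug (Pi.single a 1)))
    refine ⟨(freeProjection K σ (R'.deg 0)).proj (R.deg 0 a) y,
      (freeProjection K σ (R'.deg 0)).proj_mem _ _, ?_⟩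
    have := (freeProjection K σ (R'.deg 0)).map_proj P' R'.aug.toAddMonoidHom
      (fun n x hx => aug_mem_of_mem R' hℳ' hx) (R.deg 0 a) y
    refine this.trans ?_
    rw [LinearMap.toAddMonoidHom_coe, hy, P'.proj_of_mem (hf _ _ (R.aug_mem a)), if_pos rfl]
  choose y hy hy' using h
  refine ⟨Fintype.linearCombination _ y, fun a => ?_, fun x => ?_⟩
  · rw [Fintype.linearCombination_apply_single, one_smul]; exact hy a
  · conv_rhs => rw [eq_sum_smul_single x]
    rw [Fintype.linearCombination_apply, map_sum, map_sum, map_sum]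
    refine Finset.sum_congr rfl fun a _ => ?_
    rw [map_smul, map_smul, map_smul, hy']

/-- A lift of the identity, such as a composition of lifts of mutually inverse maps, is the identity
modulo the maximal ideal. -/
lemma constantCoeff_lift (R : MinimalGradedFreeResolution σ ℳ)
    (χ : (Fin (R.rank 0) → MvPolynomial σ K) →ₗ[MvPolynomial σ K]
      (Fin (R.rank 0) → MvPolynomial σ K)) (hχ : ∀ x, R.aug (χ x) = R.aug x) (a b) :
    constantCoeff ((χ (Pi.single a 1) - Pi.single a 1 : Fin (R.rank 0) → MvPolynomial σ K) b) =
      0 := by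
  obtain ⟨w, hw⟩ := (R.exact_zero (χ (Pi.single a 1) - Pi.single a 1)).1
    (by rw [map_sub, hχ, sub_self])
  rw [← hw, constantCoeff_d]

/-- A graded isomorphism of modules lifts to a graded isomorphism between the minimal free covers,
which consequently have the same number of basis elements in each degree. -/
lemma exists_lift_equiv (R : MinimalGradedFreeResolution σ ℳ)
    (R' : MinimalGradedFreeResolution σ ℳ') (P : GradingProjection ℳ) (P' : GradingProjection ℳ')
    (hℳ : IsGradedModule (σ := σ) ℳ) (hℳ' : IsGradedModule (σ := σ) ℳ')
    (f : M ≃ₗ[MvPolynomial σ K] M') (hf : ∀ n x, x ∈ ℳ n → f x ∈ ℳ' n) :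
    ∃ φ : (Fin (R.rank 0) → MvPolynomial σ K) ≃ₗ[MvPolynomial σ K]
        (Fin (R'.rank 0) → MvPolynomial σ K),
      (∀ a, φ (Pi.single a 1) ∈ freeDegree K σ (R'.deg 0) (R.deg 0 a)) ∧
      (∀ x, R'.aug (φ x) = f (R.aug x)) ∧
      ∀ j, Nat.card {a // R.deg 0 a = j} = Nat.card {a // R'.deg 0 a = j} := by
  classical
  obtain ⟨φ, hφ, hφf⟩ := exists_lift R R' P' hℳ' f.toLinearMap hf
  obtain ⟨ψ, hψ, hψf⟩ := exists_lift R' R P hℳ f.symm.toLinearMap (fun n x hx =>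
    P.mem_of_map_mem P' f.toLinearMap.toAddMonoidHom hf f.injective
      (by simpa using hx))
  have hψφ : ∀ x, R.aug ((ψ ∘ₗ φ) x) = R.aug x := fun x => by
    rw [LinearMap.comp_apply, hψf, hφf]; simp
  have hφψ : ∀ x, R'.aug ((φ ∘ₗ ψ) x) = R'.aug x := fun x => by
    rw [LinearMap.comp_apply, hφf, hψf]; simp
  have s1 := surjective_of_unitriangular (ψ ∘ₗ φ) (fun a =>
    map_mem_of_mem_freeDegree (isGradedModule_freeDegree _) ψ hψ (hφ a)) (constantCoeff_lift R _ hψφ)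
  have s2 := surjective_of_unitriangular (φ ∘ₗ ψ) (fun a =>
    map_mem_of_mem_freeDegree (isGradedModule_freeDegree _) φ hφ (hψ a))
    (constantCoeff_lift R' _ hφψ)
  have i1 := OrzechProperty.injective_of_surjective_endomorphism _ s1
  refine ⟨LinearEquiv.ofBijective φ ⟨Function.Injective.of_comp i1, Function.Surjective.of_comp s2⟩,
    hφ, hφf, fun j => ?_⟩
  rw [Nat.card_eq_fintype_card, Nat.card_eq_fintype_card]
  exact Matrix.square_of_invertible _ _
    (constantCoeff_matrix_mul φ ψ hφ (constantCoeff_lift R _ hψφ) j)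
    (constantCoeff_matrix_mul ψ φ hψ (constantCoeff_lift R' _ hφψ) j)

/-- The grading of the first syzygy module. -/
noncomputable def kerDegree (R : MinimalGradedFreeResolution σ ℳ) (n : ℕ) :
    Submodule K (LinearMap.ker R.aug) :=
  (freeDegree K σ (R.deg 0) n).comap ((LinearMap.ker R.aug).subtype.restrictScalars K)

/-- The projections onto the homogeneous components of the first syzygy module. -/
noncomputable def kerProjection (R : MinimalGradedFreeResolution σ ℳ) (P : GradingProjection ℳ)
    (hℳ : IsGradedModule (σ := σ) ℳ) : GradingProjection (kerDegree R) where
  proj n := (((freeProjection K σ (R.deg 0)).proj n).comp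
    (LinearMap.ker R.aug).subtype.toAddMonoidHom).codRestrict (LinearMap.ker R.aug) (by
      rintro ⟨x, hx⟩
      have := (freeProjection K σ (R.deg 0)).map_proj P R.aug.toAddMonoidHom
        (fun n x hx => aug_mem_of_mem R hℳ hx) n x
      refine LinearMap.mem_ker.2 (this.trans ?_)
      rw [LinearMap.toAddMonoidHom_coe, LinearMap.mem_ker.1 hx, map_zero])
  proj_mem n x := (freeProjection K σ (R.deg 0)).proj_mem n x.1
  proj_of_mem := by
    intro m n x hx
    refine Subtype.ext (((freeProjection K σ (R.deg 0)).proj_of_mem hx).trans ?_)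
    split_ifs <;> rfl
  exists_sum := by
    intro x
    obtain ⟨N, hN⟩ := (freeProjection K σ (R.deg 0)).exists_sum x.1
    refine ⟨N, Subtype.ext ?_⟩
    rw [AddSubmonoidClass.coe_finsetSum]
    exact hN

lemma isGradedModule_kerDegree (R : MinimalGradedFreeResolution σ ℳ) :
    IsGradedModule (σ := σ) (kerDegree R) := fun hp hx =>
  isGradedModule_freeDegree (R.deg 0) hp hx

/-- Truncating a minimal resolution gives one of the first syzygy module. -/
noncomputable def tail (R : MinimalGradedFreeResolution σ ℳ) :
    MinimalGradedFreeResolution σ (kerDegree R) where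
  rank i := R.rank (i + 1)
  deg i := R.deg (i + 1)
  aug := (R.d 0).codRestrict (LinearMap.ker R.aug) fun x => (R.exact_zero _).2 ⟨x, rfl⟩
  d i := R.d (i + 1)
  aug_mem a := d_mem_freeDegree R 0 a
  d_homogeneous i := R.d_homogeneous (i + 1)
  minimal i := R.minimal (i + 1)
  aug_surjective := by
    rintro ⟨x, hx⟩
    obtain ⟨w, hw⟩ := (R.exact_zero x).1 hx
    exact ⟨w, Subtype.ext hw⟩
  exact_zero := by
    intro x
    rw [← R.exact_succ 0 x]
    exact Subtype.ext_iff
  exact_succ i := R.exact_succ (i + 1)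

end Betti

/-- Minimal resolutions of isomorphic graded modules have bases of the same degrees. The isomorphism
of the minimal covers restricts to one of the first syzygy modules, which gives the induction on
the homological degree. -/
theorem card_deg_eq {K : Type u} [Field K] {σ : Type v} (i j : ℕ) :
    ∀ {M M' : Type (max u v)} [AddCommGroup M] [Module K M]
      [Module (MvPolynomial σ K) M] [AddCommGroup M'] [Module K M'] [Module (MvPolynomial σ K) M']
      {ℳ : ℕ → Submodule K M} {ℳ' : ℕ → Submodule K M'} (R : MinimalGradedFreeResolution σ ℳ)
      (R' : MinimalGradedFreeResolution σ ℳ') (_ : GradingProjection ℳ) (_ : GradingProjection ℳ')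
      (_ : IsGradedModule (σ := σ) ℳ) (_ : IsGradedModule (σ := σ) ℳ')
      (f : M ≃ₗ[MvPolynomial σ K] M') (_ : ∀ n x, x ∈ ℳ n → f x ∈ ℳ' n),
      Nat.card {a // R.deg i a = j} = Nat.card {a // R'.deg i a = j} := by
  induction i with
  | zero =>
    intro M M' _ _ _ _ _ _ ℳ ℳ' R R' P P' hℳ hℳ' f hf
    obtain ⟨φ, -, -, h⟩ := exists_lift_equiv R R' P P' hℳ hℳ' f hf
    exact h j
  | succ i ih =>
    intro M M' _ _ _ _ _ _ ℳ ℳ' R R' P P' hℳ hℳ' f hf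
    obtain ⟨φ, hφ, hφf, -⟩ := exists_lift_equiv R R' P P' hℳ hℳ' f hf
    have hker : ∀ x, φ x ∈ LinearMap.ker R'.aug ↔ x ∈ LinearMap.ker R.aug := by
      intro x
      rw [LinearMap.mem_ker, LinearMap.mem_ker, hφf, EmbeddingLike.map_eq_zero_iff]
    have hmap : (LinearMap.ker R.aug).map (φ : _ →ₗ[MvPolynomial σ K] _) =
        LinearMap.ker R'.aug := by
      ext y
      constructor
      · rintro ⟨x, hx, rfl⟩
        exact (hker x).2 hx
      · intro hy
        obtain ⟨x, rfl⟩ := φ.surjective y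
        exact ⟨x, (hker x).1 hy, rfl⟩
    exact ih (tail R) (tail R') (kerProjection R P hℳ) (kerProjection R' P' hℳ')
      (isGradedModule_kerDegree R) (isGradedModule_kerDegree R')
      (φ.ofSubmodules _ _ hmap) (fun n x hx => map_mem_of_mem_freeDegree
        (isGradedModule_freeDegree _) φ.toLinearMap hφ hx)

/-- The graded Betti numbers can be read off from any minimal resolution. -/
theorem gradedBetti_eq {K : Type u} [Field K] {σ : Type v} {M : Type (max u v)} [AddCommGroup M]
    [Module K M] [Module (MvPolynomial σ K) M] {ℳ : ℕ → Submodule K M}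
    (R : MinimalGradedFreeResolution σ ℳ) (P : GradingProjection ℳ)
    (hℳ : IsGradedModule (σ := σ) ℳ) (i j : ℕ) :
    gradedBetti σ ℳ i j = Nat.card {a // R.deg i a = j} := by
  have h : Nonempty (MinimalGradedFreeResolution σ ℳ) := ⟨R⟩
  rw [gradedBetti, dif_pos h]
  exact card_deg_eq i j h.some R P P hℳ hℳ (LinearEquiv.refl _ _) fun _ _ hx => hx

end BinomialEdge

/-! ### Regularity from a resolution of the cyclic module -/

namespace BinomialEdge

open MvPolynomial

universe u v

variable {K : Type u} [Field K] {σ : Type v}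

/-- The projections onto the homogeneous components of a homogeneous ideal. -/
noncomputable def degreePartProjection (J : Ideal (MvPolynomial σ K))
    (hJ : ∀ p ∈ J, ∀ n, homogeneousComponent n p ∈ J) : GradingProjection J.degreePart where
  proj n := ((homogeneousComponent n).toAddMonoidHom.comp J.subtype.toAddMonoidHom).codRestrict J
    fun x => hJ _ x.2 n
  proj_mem n x := homogeneousComponent_isHomogeneous n x.1
  proj_of_mem := by
    intro m n x hx
    refine Subtype.ext ((homogeneousComponent_of_mem hx).trans ?_)
    simp only [eq_comm (a := n)]
    split_ifs <;> rfl
  exists_sum := by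
    intro x
    refine ⟨x.1.totalDegree + 1, Subtype.ext ?_⟩
    rw [AddSubmonoidClass.coe_finsetSum]
    exact (sum_homogeneousComponent x.1).symm

lemma isGradedModule_degreePart (J : Ideal (MvPolynomial σ K)) :
    IsGradedModule (σ := σ) J.degreePart := by
  intro k l p x hp hx
  change (p * x.1).IsHomogeneous (l + k)
  rw [mul_comm]
  exact IsHomogeneous.mul hx hp

namespace CyclicResolution

variable {J : Ideal (MvPolynomial σ K)} {I : Type*} (F : CyclicResolution J I)

/-- The number of basis elements of homological degree `i + 1`. -/
noncomputable def fiberRank (i : ℕ) : ℕ := Nat.card {a // F.hdeg a = i + 1}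

/-- An enumeration of the basis elements of homological degree `i + 1`. -/
noncomputable def fiberEquiv (i : ℕ) : Fin (F.fiberRank i) ≃ {a // F.hdeg a = i + 1} :=
  have : Finite {a // F.hdeg a = i + 1} := F.finite (i + 1)
  (Finite.equivFin _).symm

/-- The inclusion of the free module of homological degree `i + 1`. -/
noncomputable def incl (i : ℕ) : (Fin (F.fiberRank i) → MvPolynomial σ K)
    →ₗ[MvPolynomial σ K] (I →₀ MvPolynomial σ K) :=
  Fintype.linearCombination _ fun a => Finsupp.single (F.fiberEquiv i a).1 1

/-- The projection onto the free module of homological degree `i + 1`. -/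
noncomputable def proj (i : ℕ) : (I →₀ MvPolynomial σ K)
    →ₗ[MvPolynomial σ K] (Fin (F.fiberRank i) → MvPolynomial σ K) :=
  LinearMap.pi fun a => Finsupp.lapply (F.fiberEquiv i a).1

lemma proj_apply (i : ℕ) (z : I →₀ MvPolynomial σ K) (a : Fin (F.fiberRank i)) :
    F.proj i z a = z (F.fiberEquiv i a).1 := rfl

lemma incl_single (i : ℕ) (a : Fin (F.fiberRank i)) :
    F.incl i (Pi.single a 1) = Finsupp.single (F.fiberEquiv i a).1 1 := by
  classical
  rw [incl, Fintype.linearCombination_apply_single, one_smul]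

lemma proj_incl (i : ℕ) (x : Fin (F.fiberRank i) → MvPolynomial σ K) :
    F.proj i (F.incl i x) = x := by
  classical
  ext1 a
  simp [proj_apply, incl, Fintype.linearCombination_apply, Finsupp.single_apply,
    ← Subtype.ext_iff]

lemma incl_apply_of_ne (i : ℕ) (x : Fin (F.fiberRank i) → MvPolynomial σ K) {c : I}
    (hc : F.hdeg c ≠ i + 1) : F.incl i x c = 0 := by
  classical
  rw [incl, Fintype.linearCombination_apply, Finsupp.finsetSum_apply]
  refine Finset.sum_eq_zero fun a _ => ?_
  rw [Finsupp.smul_apply, Finsupp.single_apply, if_neg, smul_zero]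
  intro h
  exact hc (h ▸ (F.fiberEquiv i a).2)

lemma filter_incl (i : ℕ) (x : Fin (F.fiberRank i) → MvPolynomial σ K) :
    (F.incl i x).filter (fun a => F.hdeg a = i + 1) = F.incl i x :=
  (Finsupp.filter_eq_self_iff _ _).2 fun c hc => by
    by_contra h
    exact hc (F.incl_apply_of_ne i x h)

lemma incl_proj (i : ℕ) (z : I →₀ MvPolynomial σ K) :
    F.incl i (F.proj i z) = z.filter fun a => F.hdeg a = i + 1 := by
  classical
  ext1 c
  rw [Finsupp.filter_apply]
  split_ifs with h
  · have h1 := congrFun (F.proj_incl i (F.proj i z)) ((F.fiberEquiv i).symm ⟨c, h⟩)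
    rwa [proj_apply, proj_apply, Equiv.apply_symm_apply] at h1
  · exact F.incl_apply_of_ne i _ h

/-- The differential between the free modules of homological degrees `i + 2` and `i + 1`. -/
noncomputable def fiberD (i : ℕ) : (Fin (F.fiberRank (i + 1)) → MvPolynomial σ K)
    →ₗ[MvPolynomial σ K] (Fin (F.fiberRank i) → MvPolynomial σ K) :=
  F.proj i ∘ₗ F.d ∘ₗ F.incl (i + 1)

lemma incl_fiberD (i : ℕ) (x : Fin (F.fiberRank (i + 1)) → MvPolynomial σ K) :
    F.incl i (F.fiberD i x) = F.d (F.incl (i + 1) x) := by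
  rw [fiberD, LinearMap.comp_apply, LinearMap.comp_apply, incl_proj, filter_d, filter_incl]

/-- The augmentation onto the ideal. -/
noncomputable def fiberAug :
    (Fin (F.fiberRank 0) → MvPolynomial σ K) →ₗ[MvPolynomial σ K] J :=
  (Finsupp.lapply F.o ∘ₗ F.d ∘ₗ F.incl 0).codRestrict J fun _ => F.d_apply_o_mem _

lemma single_fiberAug (x : Fin (F.fiberRank 0) → MvPolynomial σ K) :
    F.d (F.incl 0 x) = Finsupp.single F.o (F.fiberAug x).1 := by
  classical
  have h1 := F.filter_d 0 (F.incl 0 x)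
  rw [F.filter_incl] at h1
  rw [← h1]
  ext1 c
  rw [Finsupp.filter_apply, Finsupp.single_apply]
  by_cases h : F.o = c
  · subst h; rw [if_pos F.hdeg_o, if_pos rfl]; rfl
  · rw [if_neg fun h' => h ((F.hdeg_eq_zero c).1 h').symm, if_neg h]

lemma exists_fiberD_eq (i : ℕ) {y : Fin (F.fiberRank i) → MvPolynomial σ K}
    (hy : F.d (F.incl i y) = 0) : ∃ x, F.fiberD i x = y := by
  obtain ⟨w, r, h⟩ := F.exact _ hy
  refine ⟨F.proj (i + 1) w, ?_⟩
  have h1 : F.incl i y = F.d (F.incl (i + 1) (F.proj (i + 1) w)) := by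
    rw [incl_proj, ← filter_d, ← F.filter_incl i y, h, Finsupp.filter_add,
      Finsupp.filter_single_of_neg (p := fun a => F.hdeg a = i + 1)
        (by rw [F.hdeg_o]; omega), add_zero]
  rw [← incl_fiberD] at h1
  rw [← F.proj_incl i y, h1, proj_incl]

/-- A minimal resolution of `S / J` without its term in homological degree zero is a minimal
resolution of `J`. -/
noncomputable def toIdealResolution : MinimalGradedFreeResolution σ J.degreePart where
  rank := F.fiberRank
  deg i a := F.deg (F.fiberEquiv i a).1
  aug := F.fiberAug
  d := F.fiberD
  aug_mem a := by
    change (F.d (F.incl 0 (Pi.single a 1)) F.o).IsHomogeneous _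
    rw [incl_single]
    have := F.deg_d (F.fiberEquiv 0 a).1 F.o
    rwa [F.deg_o, ← zero_add (F.deg _), mem_shiftedHomogeneous_add] at this
  d_homogeneous i a b := by
    rw [fiberD, LinearMap.comp_apply, LinearMap.comp_apply, incl_single, proj_apply]
    exact mem_shiftedHomogeneous_iff.1 (F.deg_d _ _)
  minimal i a b := F.constantCoeff_d _ _
  aug_surjective := by
    rintro ⟨r, hr⟩
    obtain ⟨w, hw⟩ := F.single_mem_of_mem hr
    refine ⟨F.proj 0 w, Subtype.ext ?_⟩
    have h1 := F.single_fiberAug (F.proj 0 w)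
    rw [incl_proj, ← filter_d, hw,
      Finsupp.filter_single_of_pos (p := fun a => F.hdeg a = 0) F.hdeg_o] at h1
    exact (Finsupp.single_injective _ h1).symm
  exact_zero := by
    intro y
    constructor
    · intro h
      refine F.exists_fiberD_eq 0 ?_
      rw [single_fiberAug, h, ZeroMemClass.coe_zero, Finsupp.single_zero]
    · rintro ⟨x, rfl⟩
      refine Subtype.ext (Finsupp.single_injective F.o ?_)
      rw [← single_fiberAug, incl_fiberD, F.d_d, ZeroMemClass.coe_zero, Finsupp.single_zero]
  exact_succ := by
    intro i y
    constructor
    · intro h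
      refine F.exists_fiberD_eq (i + 1) ?_
      rw [← incl_fiberD, h, map_zero]
    · rintro ⟨x, rfl⟩
      rw [← F.proj_incl i (F.fiberD i _), incl_fiberD, incl_fiberD, F.d_d, map_zero]

lemma gradedBetti_ne_zero_iff (hJ : ∀ p ∈ J, ∀ n, homogeneousComponent n p ∈ J) (i j : ℕ) :
    gradedBetti σ J.degreePart i j ≠ 0 ↔ ∃ a, F.hdeg a = i + 1 ∧ F.deg a = j := by
  rw [gradedBetti_eq F.toIdealResolution (degreePartProjection J hJ) (isGradedModule_degreePart J),
    Nat.card_ne_zero]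
  constructor
  · rintro ⟨⟨a, ha⟩, -⟩
    exact ⟨_, (F.fiberEquiv i a).2, ha⟩
  · rintro ⟨a, ha, haj⟩
    have : Finite (Fin (F.toIdealResolution.rank i)) := Finite.of_fintype _
    refine ⟨⟨⟨(F.fiberEquiv i).symm ⟨a, ha⟩, ?_⟩⟩, inferInstance⟩
    change F.deg (F.fiberEquiv i ((F.fiberEquiv i).symm ⟨a, ha⟩)).1 = j
    rw [Equiv.apply_symm_apply, haj]

lemma d_ne_zero {a : I} (ha : a ≠ F.o) : F.d (Finsupp.single a 1) ≠ 0 := by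
  intro h
  obtain ⟨w, r, hw⟩ := F.exact _ h
  have h1 := congrArg (fun z => constantCoeff (z a)) hw
  simp [Finsupp.single_eq_of_ne ha, F.constantCoeff_d] at h1

/-- The resolution of `S` itself has no terms in positive homological degrees. -/
lemma eq_o_of_eq_bot (hJ : J = ⊥) (a : I) : a = F.o := by
  have key : ∀ n a, F.hdeg a = n + 1 → False := by
    intro n
    induction n with
    | zero =>
      intro a ha
      have h1 := F.d_of_hdeg_one ha
      have h2 := (Submodule.mem_bot _).1 (hJ.le (F.d_apply_o_mem (Finsupp.single a 1)))
      rw [h2, Finsupp.single_zero] at h1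
      refine F.d_ne_zero ?_ h1
      rintro rfl
      rw [F.hdeg_o] at ha
      omega
    | succ n ih =>
      intro a ha
      refine F.d_ne_zero (a := a) (by rintro rfl; rw [F.hdeg_o] at ha; omega) ?_
      ext1 b
      by_contra h
      have := F.hdeg_d a b h
      exact ih b (by omega)
  rw [← F.hdeg_eq_zero]
  by_contra h
  exact key (F.hdeg a - 1) a (by omega)

lemma exists_hdeg_one (hJ : J ≠ ⊥) : ∃ a, F.hdeg a = 1 ∧ 1 ≤ F.deg a := by
  obtain ⟨r, hr, hr0⟩ := Submodule.exists_mem_ne_zero_of_ne_bot hJ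
  obtain ⟨w, hw⟩ := F.single_mem_of_mem hr
  obtain ⟨a, ha⟩ : ∃ a, F.d (Finsupp.single a 1) F.o ≠ 0 := by
    by_contra! h
    have h1 : ∀ w, F.d w F.o = 0 := by
      intro w
      induction w using Finsupp.induction_linear with
      | zero => simp
      | add f g hf hg => rw [map_add, Finsupp.add_apply, hf, hg, add_zero]
      | single a r => rw [d_single, Finsupp.smul_apply, h, smul_zero]
    have := h1 w
    rw [hw, Finsupp.single_eq_same] at this
    exact hr0 this
  refine ⟨a, ?_, ?_⟩
  · have := F.hdeg_d a F.o ha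
    rw [F.hdeg_o] at this
    omega
  · by_contra h
    exact ha (eq_zero_of_mem_of_constantCoeff (F.deg_d a F.o) (F.minimal a F.o) (by omega))

end CyclicResolution

/-- The regularity of `J` is the one of `S / J` plus one. -/
theorem HasRegularity.regularity_eq {J : Ideal (MvPolynomial σ K)} {r : EReal}
    (h : HasRegularity J r) (hJ : ∀ p ∈ J, ∀ n, homogeneousComponent n p ∈ J) :
    J.regularity = r + 1 := by
  obtain ⟨I, F, rfl⟩ := h
  rw [Ideal.regularity]
  split_ifs with h0
  · have h1 : ∀ a, (((F.deg a : ℝ) - (F.hdeg a : ℝ) : ℝ) : EReal) = 0 := by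
      intro a
      rw [F.eq_o_of_eq_bot h0 a, F.deg_o, F.hdeg_o]
      simp
    have : Nonempty I := ⟨F.o⟩
    simp only [h1]
    rw [ciSup_const, zero_add]
  rw [moduleRegularity, ereal_iSup_add_const]
  have hval : ∀ a i, F.hdeg a = i + 1 →
      (((F.deg a : ℝ) - (F.hdeg a : ℝ) : ℝ) : EReal) + 1 =
        (((F.deg a : ℝ) - (i : ℝ) : ℝ) : EReal) := by
    intro a i ha
    rw [← EReal.coe_one, ← EReal.coe_add, ha]
    congr 1
    push_cast
    ring
  have hle : ∀ a i, F.hdeg a = i + 1 → (((F.deg a : ℝ) - (F.hdeg a : ℝ) : ℝ) : EReal) + 1 ≤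
      ⨆ (i : ℕ) (j : ℕ) (_ : gradedBetti σ J.degreePart i j ≠ 0),
        (((j : ℝ) - (i : ℝ) : ℝ) : EReal) := by
    intro a i ha
    rw [hval a i ha]
    exact le_iSup_of_le i (le_iSup_of_le (F.deg a) (le_iSup_of_le
      ((F.gradedBetti_ne_zero_iff hJ i (F.deg a)).2 ⟨a, ha, rfl⟩) le_rfl))
  refine le_antisymm (iSup_le fun i => iSup_le fun j => iSup_le fun hij => ?_) (iSup_le fun a => ?_)
  · obtain ⟨a, ha, rfl⟩ := (F.gradedBetti_ne_zero_iff hJ i j).1 hij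
    rw [← hval a i ha]
    exact le_iSup (fun a => (((F.deg a : ℝ) - (F.hdeg a : ℝ) : ℝ) : EReal) + 1) a
  · by_cases ha : a = F.o
    -- The basis element `o` is missing in the resolution of `J`, but a generator of `J` has at least
    -- the same value.
    · obtain ⟨b, hb, hb1⟩ := F.exists_hdeg_one h0
      refine le_trans (add_le_add ?_ le_rfl) (hle b 0 hb)
      rw [ha, F.deg_o, F.hdeg_o, hb, EReal.coe_le_coe_iff]
      have : (1 : ℝ) ≤ F.deg b := by exact_mod_cast hb1
      push_cast
      linarith
    · have : F.hdeg a ≠ 0 := fun h => ha ((F.hdeg_eq_zero a).1 h)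
      exact hle a (F.hdeg a - 1) (by omega)

end BinomialEdge

/-! ### Binomial edge ideals are homogeneous -/

namespace BinomialEdge

open MvPolynomial

variable {K : Type*} [Field K]

lemma edge_binomial_isHomogeneous {V : Type*} (v w : V) :
    (X (Sum.inl v) * X (Sum.inr w) - X (Sum.inl w) * X (Sum.inr v) :
      MvPolynomial (V ⊕ V) K).IsHomogeneous 2 :=
  ((isHomogeneous_X _ _).mul (isHomogeneous_X _ _)).sub
    ((isHomogeneous_X _ _).mul (isHomogeneous_X _ _))

lemma homogeneousComponent_mem {V : Type*} (G : SimpleGraph V) (p : MvPolynomial (V ⊕ V) K)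
    (hp : p ∈ G.binomialEdgeIdeal K) (n : ℕ) :
    homogeneousComponent n p ∈ G.binomialEdgeIdeal K := by
  have key : shiftedComponent K (V ⊕ V) 0 n p ∈ G.binomialEdgeIdeal K := by
    refine Submodule.closure_induction (p := fun p _ => shiftedComponent K (V ⊕ V) 0 n p ∈
      G.binomialEdgeIdeal K) ?_ ?_ ?_ hp
    · rw [map_zero]; exact zero_mem _
    · intro x y _ _ hx hy
      rw [map_add]; exact add_mem hx hy
    · rintro r _ ⟨v, w, h, rfl⟩
      rw [smul_eq_mul, shiftedComponent_mul r (mem_shiftedHomogeneous_add.2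
        (edge_binomial_isHomogeneous v w))]
      exact Ideal.mul_mem_left _ _ (Ideal.subset_span ⟨v, w, h, rfl⟩)
  rwa [shiftedComponent, if_pos (Nat.zero_le n)] at key

lemma constantCoeff_of_mem {V : Type*} (G : SimpleGraph V) (p : MvPolynomial (V ⊕ V) K)
    (hp : p ∈ G.binomialEdgeIdeal K) : constantCoeff p = 0 := by
  have : G.binomialEdgeIdeal K ≤ RingHom.ker constantCoeff := by
    refine Ideal.span_le.2 ?_
    rintro _ ⟨v, w, -, rfl⟩
    simp [RingHom.mem_ker]
  exact this hp

/-! ### Disjoint unions -/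

lemma binomialEdgeIdeal_sum {V₁ V₂ V : Type*} {G₁ : SimpleGraph V₁} {G₂ : SimpleGraph V₂}
    {G : SimpleGraph V} (e : G₁ ⊕g G₂ ≃g G) :
    (G₁.binomialEdgeIdeal K).map (rename (R := K)
        (((Equiv.sumSumSumComm V₁ V₁ V₂ V₂).trans (e.toEquiv.sumCongr e.toEquiv)) ∘ Sum.inl)) ⊔
      (G₂.binomialEdgeIdeal K).map (rename (R := K)
        (((Equiv.sumSumSumComm V₁ V₁ V₂ V₂).trans (e.toEquiv.sumCongr e.toEquiv)) ∘ Sum.inr)) =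
      G.binomialEdgeIdeal K := by
  refine le_antisymm (sup_le ?_ ?_) ?_
  · rw [SimpleGraph.binomialEdgeIdeal, Ideal.map_span, Ideal.span_le]
    rintro _ ⟨_, ⟨v, w, h, rfl⟩, rfl⟩
    refine Ideal.subset_span ⟨e (Sum.inl v), e (Sum.inl w), e.map_rel_iff.2 (by simpa using h), ?_⟩
    simp
  · rw [SimpleGraph.binomialEdgeIdeal, Ideal.map_span, Ideal.span_le]
    rintro _ ⟨_, ⟨v, w, h, rfl⟩, rfl⟩
    refine Ideal.subset_span ⟨e (Sum.inr v), e (Sum.inr w), e.map_rel_iff.2 (by simpa using h), ?_⟩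
    simp
  · refine Ideal.span_le.2 ?_
    rintro _ ⟨v, w, h, rfl⟩
    obtain ⟨v, rfl⟩ := e.surjective v
    obtain ⟨w, rfl⟩ := e.surjective w
    have h' := e.map_rel_iff.1 h
    rcases v with v | v <;> rcases w with w | w
    · refine Ideal.mem_sup_left ?_
      have hm : (X (Sum.inl v) * X (Sum.inr w) - X (Sum.inl w) * X (Sum.inr v) :
          MvPolynomial (V₁ ⊕ V₁) K) ∈ G₁.binomialEdgeIdeal K :=
        Ideal.subset_span ⟨v, w, by simpa using h', rfl⟩
      have := Ideal.mem_map_of_mem (rename (R := K)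
        (((Equiv.sumSumSumComm V₁ V₁ V₂ V₂).trans (e.toEquiv.sumCongr e.toEquiv)) ∘ Sum.inl))
        hm
      simpa using this
    · simp at h'
    · simp at h'
    · refine Ideal.mem_sup_right ?_
      have hm : (X (Sum.inl v) * X (Sum.inr w) - X (Sum.inl w) * X (Sum.inr v) :
          MvPolynomial (V₂ ⊕ V₂) K) ∈ G₂.binomialEdgeIdeal K :=
        Ideal.subset_span ⟨v, w, by simpa using h', rfl⟩
      have := Ideal.mem_map_of_mem (rename (R := K)
        (((Equiv.sumSumSumComm V₁ V₁ V₂ V₂).trans (e.toEquiv.sumCongr e.toEquiv)) ∘ Sum.inr))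
        hm
      simpa using this

theorem HasRegularity.graph_sum {V₁ V₂ V : Type*} {G₁ : SimpleGraph V₁} {G₂ : SimpleGraph V₂}
    {G : SimpleGraph V} {r₁ r₂ : EReal} (h₁ : HasRegularity (G₁.binomialEdgeIdeal K) r₁)
    (h₂ : HasRegularity (G₂.binomialEdgeIdeal K) r₂) (e : G₁ ⊕g G₂ ≃g G) :
    HasRegularity (G.binomialEdgeIdeal K) (r₁ + r₂) := by
  rw [← binomialEdgeIdeal_sum e]
  exact h₁.tensor h₂ _

variable (K) in
lemma hasRegularity_bot (σ : Type*) : HasRegularity (⊥ : Ideal (MvPolynomial σ K)) 0 := by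
  refine ⟨Unit,
    { hdeg := 0
      deg := 0
      d := 0
      o := ()
      deg_o := rfl
      hdeg_eq_zero := by simp
      hdeg_d := by simp
      deg_d := fun a b => zero_mem _
      minimal := by simp
      d_d := by simp
      exact := fun z _ => ⟨0, z (), by ext1; simp⟩
      mem_iff := by simp [eq_comm]
      finite := fun n => Set.toFinite _ }, by simp⟩

lemma binomialEdgeIdeal_of_isEmpty {V : Type*} [IsEmpty V] (G : SimpleGraph V) :
    G.binomialEdgeIdeal K = ⊥ := by
  rw [SimpleGraph.binomialEdgeIdeal, Ideal.span_eq_bot]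
  rintro _ ⟨v, _⟩
  exact isEmptyElim v

/-- An isomorphism is treated as a disjoint union with the empty graph. -/
theorem HasRegularity.graph_iso {V₁ V : Type*} {G₁ : SimpleGraph V₁} {G : SimpleGraph V}
    {r : EReal} (h : HasRegularity (G₁.binomialEdgeIdeal K) r) (e : G₁ ≃g G) :
    HasRegularity (G.binomialEdgeIdeal K) r := by
  have h0 : HasRegularity ((⊥ : SimpleGraph Empty).binomialEdgeIdeal K) 0 := by
    rw [binomialEdgeIdeal_of_isEmpty]; exact hasRegularity_bot K _
  rw [← add_zero r]
  refine h.graph_sum h0 ⟨(Equiv.sumEmpty V₁ Empty).trans e.toEquiv, ?_⟩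
  rintro (a | a) (b | b)
  · simpa using e.map_rel_iff
  all_goals exact isEmptyElim ‹Empty›

/-- The regularity of `S / J_H` is the sum over the connected components of `H`. -/
theorem hasRegularity_of_components {V : Type*} (H : SimpleGraph V)
    [Fintype H.ConnectedComponent] (r : H.ConnectedComponent → EReal)
    (hr : ∀ C : H.ConnectedComponent, HasRegularity (C.toSimpleGraph.binomialEdgeIdeal K) (r C)) :
    HasRegularity (H.binomialEdgeIdeal K) (∑ C, r C) := by
  classical
  have key : ∀ T : Finset H.ConnectedComponent, HasRegularity
      ((H.induce {v | H.connectedComponentMk v ∈ T}).binomialEdgeIdeal K) (∑ C ∈ T, r C) := by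
    intro T
    induction T using Finset.induction_on with
    | empty =>
      have : IsEmpty {v | H.connectedComponentMk v ∈ (∅ : Finset H.ConnectedComponent)} := by simp
      rw [binomialEdgeIdeal_of_isEmpty, Finset.sum_empty]
      exact hasRegularity_bot K _
    | insert C T hC ih =>
      rw [Finset.sum_insert hC]
      let f : C ⊕ {v | H.connectedComponentMk v ∈ T} →
          {v | H.connectedComponentMk v ∈ insert C T} :=
        Sum.elim (fun v => ⟨v.1, Finset.mem_insert.2 (Or.inl v.2)⟩)
          fun v => ⟨v.1, Finset.mem_insert_of_mem v.2⟩
      have hf : Function.Bijective f := by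
        constructor
        · rintro (⟨a, ha⟩ | ⟨a, ha⟩) (⟨b, hb⟩ | ⟨b, hb⟩) hab
          · obtain rfl : a = b := congrArg Subtype.val hab
            rfl
          · obtain rfl : a = b := congrArg Subtype.val hab
            exact absurd (ha ▸ hb : C ∈ T) hC
          · obtain rfl : a = b := congrArg Subtype.val hab
            exact absurd (hb ▸ ha : C ∈ T) hC
          · obtain rfl : a = b := congrArg Subtype.val hab
            rfl
        · rintro ⟨a, ha⟩
          rcases Finset.mem_insert.1 ha with h | h
          · exact ⟨Sum.inl ⟨a, h⟩, rfl⟩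
          · exact ⟨Sum.inr ⟨a, h⟩, rfl⟩
      refine (hr C).graph_sum ih ⟨Equiv.ofBijective f hf, ?_⟩
      have hno : ∀ a b, H.connectedComponentMk a = C → H.connectedComponentMk b ∈ T →
          ¬ H.Adj a b := by
        intro a b ha hb hab
        rw [← SimpleGraph.ConnectedComponent.connectedComponentMk_eq_of_adj hab, ha] at hb
        exact hC hb
      rintro (⟨a, ha⟩ | ⟨a, ha⟩) (⟨b, hb⟩ | ⟨b, hb⟩)
      · exact Iff.rfl
      · exact iff_of_false (hno a b ha hb) (by simp)
      · exact iff_of_false (fun h => hno b a hb ha h.symm) (by simp)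
      · exact Iff.rfl
  refine (key Finset.univ).graph_iso
    ⟨(Equiv.subtypeUnivEquiv fun v => Finset.mem_univ _), ?_⟩
  intro a b
  exact Iff.rfl

/-! ### Free cut edges -/

lemma isClique_neighborSet_of_isFreeVertex {V : Type*} [Finite V] {G : SimpleGraph V} {v : V}
    (hv : G.IsFreeVertex v) : G.IsClique (G.neighborSet v) := by
  intro a ha b hb hab
  have ext : ∀ c, G.Adj v c → ∃ s, Maximal G.IsClique s ∧ v ∈ s ∧ c ∈ s := by
    intro c hc
    have h1 : G.IsClique ({v, c} : Set V) := by
      rw [SimpleGraph.isClique_pair]; exact fun _ => hc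
    obtain ⟨s, hs, hmax⟩ := (Set.toFinite {s : Set V | G.IsClique s}).exists_le_maximal h1
    exact ⟨s, hmax, hs (by simp), hs (by simp)⟩
  obtain ⟨s, hs, hvs, has⟩ := ext a ha
  obtain ⟨t, ht, hvt, hbt⟩ := ext b hb
  obtain rfl := hv.unique ⟨hs, hvs⟩ ⟨ht, hvt⟩
  exact hs.prop has hbt hab

/-- A walk in `G` which uses the additional edge `vw` joins vertices that are connected to `v` or `w`
in `H`. -/
lemma reachable_or_of_reachable {V : Type*} {G H : SimpleGraph V} {v w : V}
    (hGH : ∀ a b, G.Adj a b → H.Adj a b ∨ s(a, b) = s(v, w)) {a b : V} (h : G.Reachable a b) :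
    H.Reachable a b ∨
      ((H.Reachable a v ∨ H.Reachable a w) ∧ (H.Reachable b v ∨ H.Reachable b w)) := by
  rw [SimpleGraph.reachable_iff_reflTransGen] at h
  induction h with
  | refl => exact Or.inl (SimpleGraph.Reachable.refl _)
  | @tail b c _ hbc ih =>
    rcases hGH b c hbc with h1 | h1
    · rcases ih with h2 | ⟨h2, h3⟩
      · exact Or.inl (h2.trans h1.reachable)
      · exact Or.inr ⟨h2, h3.imp h1.symm.reachable.trans h1.symm.reachable.trans⟩
    · have hc : H.Reachable c v ∨ H.Reachable c w := by
        rcases Sym2.eq_iff.1 h1 with ⟨-, rfl⟩ | ⟨-, rfl⟩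
        · exact Or.inr (SimpleGraph.Reachable.refl _)
        · exact Or.inl (SimpleGraph.Reachable.refl _)
      refine Or.inr ⟨?_, hc⟩
      rcases ih with h2 | ⟨h2, -⟩
      · rcases Sym2.eq_iff.1 h1 with ⟨rfl, -⟩ | ⟨rfl, -⟩
        · exact Or.inl h2
        · exact Or.inr h2
      · exact h2

/-- Removing a bridge increases the number of connected components by one. -/
lemma card_connectedComponent_of_bridge {V : Type*} [Finite V] {G H : SimpleGraph V} {v w : V}
    (hHG : H ≤ G) (hGH : ∀ a b, G.Adj a b → H.Adj a b ∨ s(a, b) = s(v, w)) (hvw : G.Adj v w)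
    (hnot : ¬ H.Reachable v w) :
    Nat.card H.ConnectedComponent = Nat.card G.ConnectedComponent + 1 := by
  classical
  rw [← Nat.card_congr (Equiv.optionSubtypeNe (H.connectedComponentMk w)), Finite.card_option]
  congr 1
  refine Nat.card_congr (Equiv.ofBijective (fun c => c.1.map (SimpleGraph.Hom.ofLE hHG)) ⟨?_, ?_⟩)
  · rintro ⟨c, hc⟩ ⟨c', hc'⟩ h
    induction c using SimpleGraph.ConnectedComponent.ind with
    | _ a =>
    induction c' using SimpleGraph.ConnectedComponent.ind with
    | _ b =>
    have h1 : G.Reachable a b := SimpleGraph.ConnectedComponent.exact h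
    have ha : ¬ H.Reachable a w := fun h => hc (SimpleGraph.ConnectedComponent.sound h)
    have hb : ¬ H.Reachable b w := fun h => hc' (SimpleGraph.ConnectedComponent.sound h)
    refine Subtype.ext (SimpleGraph.ConnectedComponent.sound ?_)
    rcases reachable_or_of_reachable hGH h1 with h2 | ⟨h2, h3⟩
    · exact h2
    · exact (h2.resolve_right ha).trans (h3.resolve_right hb).symm
  · intro c
    induction c using SimpleGraph.ConnectedComponent.ind with
    | _ a =>
    by_cases ha : H.Reachable a w
    · refine ⟨⟨H.connectedComponentMk v,
        fun h => hnot (SimpleGraph.ConnectedComponent.exact h)⟩, ?_⟩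
      exact SimpleGraph.ConnectedComponent.sound (hvw.reachable.trans (ha.mono hHG).symm)
    · exact ⟨⟨H.connectedComponentMk a,
        fun h => ha (SimpleGraph.ConnectedComponent.exact h)⟩, rfl⟩

/-- A vertex that is free after deleting `e` still has a clique as neighbourhood after deleting
further bridges. -/
lemma isClique_neighborSet_deleteEdges {V : Type*} [Finite V] {G : SimpleGraph V} {e : Sym2 V}
    {A : Set (Sym2 V)} (hA : ∀ e ∈ A, G.IsBridge e) {v : V}
    (hv : (G.deleteEdges {e}).IsFreeVertex v) :
    (G.deleteEdges (insert e A)).IsClique ((G.deleteEdges (insert e A)).neighborSet v) := by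
  intro a ha b hb hab
  simp only [SimpleGraph.mem_neighborSet, SimpleGraph.deleteEdges_adj, Set.mem_insert_iff,
    not_or] at ha hb
  have h1 := isClique_neighborSet_of_isFreeVertex hv
    (show a ∈ (G.deleteEdges {e}).neighborSet v by
      rw [SimpleGraph.mem_neighborSet, SimpleGraph.deleteEdges_adj]; exact ⟨ha.1, ha.2.1⟩)
    (show b ∈ (G.deleteEdges {e}).neighborSet v by
      rw [SimpleGraph.mem_neighborSet, SimpleGraph.deleteEdges_adj]; exact ⟨hb.1, hb.2.1⟩) hab
  rw [SimpleGraph.deleteEdges_adj] at h1 ⊢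
  refine ⟨h1.1, ?_⟩
  rintro (h | h)
  · exact h1.2 h
  · -- A bridge is not contained in the triangle `a, v, b`.
    refine SimpleGraph.isBridge_iff.1 (hA _ h) ?_
    have e1 : (G.deleteEdges {s(a, b)}).Adj a v := by
      rw [SimpleGraph.deleteEdges_adj]
      refine ⟨ha.1.symm, fun h => ?_⟩
      rcases Sym2.eq_iff.1 h with ⟨-, h⟩ | ⟨h, -⟩
      · exact hb.1.ne h
      · exact hab h
    have e2 : (G.deleteEdges {s(a, b)}).Adj v b := by
      rw [SimpleGraph.deleteEdges_adj]
      refine ⟨hb.1, fun h => ?_⟩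
      rcases Sym2.eq_iff.1 h with ⟨h, -⟩ | ⟨-, h⟩
      · exact ha.1.ne h
      · exact hab h.symm
    exact e1.reachable.trans e2.reachable

/-- Deleting a set of free cut edges lowers the regularity of `S / J_G` by one for each edge and
adds one connected component for each edge. -/
theorem hasRegularity_of_deleteEdges {V : Type*} [Fintype V] (G : SimpleGraph V)
    (A : Finset (Sym2 V)) (hA : ∀ e ∈ A, G.IsFreeCutEdge e) :
    Nat.card (G.deleteEdges (A : Set (Sym2 V))).ConnectedComponent =
        Nat.card G.ConnectedComponent + A.card ∧
      ∀ r, HasRegularity ((G.deleteEdges (A : Set (Sym2 V))).binomialEdgeIdeal K) r →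
        HasRegularity (G.binomialEdgeIdeal K) (r + (A.card : EReal)) := by
  classical
  induction A using Finset.induction_on with
  | empty => simp
  | insert e A he ih =>
    obtain ⟨ih1, ih2⟩ := ih fun e he => hA e (Finset.mem_insert_of_mem he)
    obtain ⟨heG, hbr, hfree⟩ := hA e (Finset.mem_insert_self _ _)
    induction e with | _ v w =>
    rw [SimpleGraph.mem_edgeSet] at heG
    rw [Finset.coe_insert]
    set H' := G.deleteEdges (A : Set (Sym2 V)) with hH'
    set H := G.deleteEdges (insert s(v, w) (A : Set (Sym2 V))) with hH
    have hle : H ≤ H' := SimpleGraph.deleteEdges_anti (Set.subset_insert _ _)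
    have hadj : ∀ a b, H'.Adj a b → H.Adj a b ∨ s(a, b) = s(v, w) := by
      intro a b h
      by_cases h1 : s(a, b) = s(v, w)
      · exact Or.inr h1
      · rw [hH', SimpleGraph.deleteEdges_adj] at h
        rw [hH, SimpleGraph.deleteEdges_adj]
        exact Or.inl ⟨h.1, fun h2 => h2.elim h1 h.2⟩
    have hvw : H'.Adj v w := by
      rw [hH', SimpleGraph.deleteEdges_adj]
      exact ⟨heG, he⟩
    have hnot : ¬ H.Reachable v w := fun h => SimpleGraph.isBridge_iff.1 hbr
      (h.mono (SimpleGraph.deleteEdges_anti (by simp)))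
    have hAb : ∀ e ∈ (A : Set (Sym2 V)), G.IsBridge e := fun e he =>
      (hA e (Finset.mem_insert_of_mem he)).2.1
    refine ⟨?_, fun r hr => ?_⟩
    · rw [card_connectedComponent_of_bridge hle hadj hvw hnot, ih1, Finset.card_insert_of_notMem he]
      ring
    · have h1 := hr.sup_span_singleton (edge_binomial_isHomogeneous (K := K) v w)
        (mem_of_binomial_mul_mem
          (isClique_neighborSet_deleteEdges hAb (hfree v (Sym2.mem_mk_left v w)))
          (isClique_neighborSet_deleteEdges hAb (hfree w (Sym2.mem_mk_right v w))) hnot)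
      have h2 : H.binomialEdgeIdeal K ⊔ Ideal.span {(X (Sum.inl v) * X (Sum.inr w) -
          X (Sum.inl w) * X (Sum.inr v) : MvPolynomial (V ⊕ V) K)} = H'.binomialEdgeIdeal K := by
        refine le_antisymm (sup_le (Ideal.span_mono ?_) ?_) (Ideal.span_le.2 ?_)
        · rintro _ ⟨a, b, hab, rfl⟩
          exact ⟨a, b, hle hab, rfl⟩
        · rw [Ideal.span_singleton_le_iff_mem]
          exact Ideal.subset_span ⟨v, w, hvw, rfl⟩
        · rintro _ ⟨a, b, hab, rfl⟩
          rcases hadj a b hab with h | h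
          · exact Ideal.mem_sup_left (Ideal.subset_span ⟨a, b, h, rfl⟩)
          · refine Ideal.mem_sup_right ?_
            rcases Sym2.eq_iff.1 h with ⟨rfl, rfl⟩ | ⟨rfl, rfl⟩
            · exact Ideal.mem_span_singleton_self _
            · exact Ideal.mem_span_singleton.2 ⟨-1, by ring⟩
      rw [h2] at h1
      have h3 := ih2 _ h1
      rwa [add_assoc, ← Nat.cast_one, ← Nat.cast_add, add_comm 1,
        ← Finset.card_insert_of_notMem he] at h3

end BinomialEdge

open BinomialEdge in
theorem mainTheorem7 {K : Type*} [Field K] {V : Type*} [Fintype V] (G : SimpleGraph V)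
    (hG : G.Connected) [Fintype G.reducedGraph.ConnectedComponent] :
    (G.binomialEdgeIdeal K).regularity =
      ∑ R : G.reducedGraph.ConnectedComponent,
        (R.toSimpleGraph.binomialEdgeIdeal K).regularity := by
  classical
  have hex : ∀ R : G.reducedGraph.ConnectedComponent, ∃ r,
      HasRegularity (R.toSimpleGraph.binomialEdgeIdeal K) r := fun R =>
    exists_hasRegularity _ (homogeneousComponent_mem _) (constantCoeff_of_mem _)
  choose r hr using hex
  set A : Finset (Sym2 V) := Finset.univ.filter G.IsFreeCutEdge with hA
  have hAG : G.reducedGraph = G.deleteEdges (A : Set (Sym2 V)) := by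
    rw [SimpleGraph.reducedGraph, hA]
    congr 1
    ext e
    simp
  obtain ⟨hcard, hreg⟩ := hasRegularity_of_deleteEdges (K := K) G A (by simp [hA])
  rw [← hAG] at hcard hreg
  have h1 := hreg _ (hasRegularity_of_components G.reducedGraph r hr)
  have : Nat.card G.ConnectedComponent = 1 := by
    have := hG.preconnected.subsingleton_connectedComponent
    have := hG.nonempty.map G.connectedComponentMk
    exact Nat.card_eq_one_iff_unique.2 ⟨inferInstance, inferInstance⟩
  rw [this, Nat.card_eq_fintype_card, add_comm] at hcard
  rw [h1.regularity_eq (homogeneousComponent_mem _), add_assoc, ← Nat.cast_one, ← Nat.cast_add,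
    ← hcard, Finset.sum_congr rfl fun R _ => (hr R).regularity_eq (homogeneousComponent_mem _),
    Finset.sum_add_distrib, Finset.sum_const, nsmul_one]
  rfl
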